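/- Consider a binary cubic equation $$K_3(x,y)\,dy^3+K_2(x,y)\,dy^2dx+K_1(x,y)\,dy\,dx^2+K_0(x,y)\,dx^3=0,$$ where the $K_i$ are germs of holomorphic functions at $(\mathbb C^2,0)$ and at least one $K_i$ does not vanish at $(0,0)$; with $p=dy/dx$ it is a cubic implicit ODE. Suppose that there are points arbitrarily close to the origin at which it has three distinct root directions and that its web of solutions is flat (hexagonal), i.e. near every such point (close enough to the origin) some local biholomorphism maps the solutions to three families of parallel lines. Suppose the equation is weighted homogeneous: its web of solutions is invariant under the local flow of a vector field $w_x x\,\partial_x+w_y y\,\partial_y$ with constants $(w_x,w_y)\in\mathbb C^2\setminus\{(0,0)\}$. If one of the weights $w_x,w_y$ vanishes, then for some nonnegative integer $N$ and constants $L_0,L_1\in\mathbb C$ the equation is equivalent to one of the following: $$ \begin{array}{cl} 1) & p^3=x^{N}y^3,\\ 2) & p^3+x^Ny^2p=\frac{2}{\sqrt{27}}\,x^{\frac{3}{2}N}y^3\tan\left(L_0x^{1+\frac{N}{2}}+L_1\right),\\ 3) & p^3+x^{N+1}y^2p+\dfrac{2\,x^{\frac{3}{2}(N+1)}y^3}{\sqrt{27}\,\tan\left(L_0x^{1+\frac{N+1}{2}}\right)}=0,\\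 4) & p\,(x^2y^Np^2+1)=0. \end{array} $$ Here equivalence means that a germ of a biholomorphism of $(\mathbb C^2,0)$ fixing the origin carries one cubic form to the other up to a non-vanishing holomorphic factor. In form 2), $L_1\notin\frac{\pi}{2}+\pi\mathbb Z$, $L_1=0$ for odd $N$, and if $L_1\neq 0$ one can choose $0\le\arg L_1<\pi$. In form 3), $L_0\ne0$. The coefficients of $y^3$ in 2) and 3) are holomorphic germs in $x$ at $0$ (in 3) after removing the singularity at $x=0$). -/

import Mathlib

open Filter Topology

noncomputable section

/-- Determinant of two vectors of `ℂ²`; it vanishes iff the vectors are linearly dependent. -/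
def det2 (a b : ℂ × ℂ) : ℂ := a.1 * b.2 - a.2 * b.1

/-- The binary cubic differential form
`K₃ dy³ + K₂ dy² dx + K₁ dy dx² + K₀ dx³` on (a neighbourhood of the origin in) `ℂ²`.
With `p = dy/dx` it is the implicit cubic ODE `K₃ p³ + K₂ p² + K₁ p + K₀ = 0`. -/
structure BinaryCubic where
  K₀ : ℂ × ℂ → ℂ
  K₁ : ℂ × ℂ → ℂ
  K₂ : ℂ × ℂ → ℂ
  K₃ : ℂ × ℂ → ℂ

namespace BinaryCubic

/-- Value of the form at the point `q = (x, y)` on the tangent vector `v = (dx, dy)`. -/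
def eval (Φ : BinaryCubic) (q v : ℂ × ℂ) : ℂ :=
  Φ.K₃ q * v.2 ^ 3 + Φ.K₂ q * v.2 ^ 2 * v.1 + Φ.K₁ q * v.2 * v.1 ^ 2 + Φ.K₀ q * v.1 ^ 3

/-- The coefficients are holomorphic at the origin and do not all vanish there. -/
def IsHolomorphicGerm (Φ : BinaryCubic) : Prop :=
  AnalyticAt ℂ Φ.K₀ 0 ∧ AnalyticAt ℂ Φ.K₁ 0 ∧ AnalyticAt ℂ Φ.K₂ 0 ∧ AnalyticAt ℂ Φ.K₃ 0 ∧
    (Φ.K₀ 0 ≠ 0 ∨ Φ.K₁ 0 ≠ 0 ∨ Φ.K₂ 0 ≠ 0 ∨ Φ.K₃ 0 ≠ 0)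

/-- The equation has three distinct root directions `dx : dy` at `q`. -/
def IsRegularAt (Φ : BinaryCubic) (q : ℂ × ℂ) : Prop :=
  (∃ w, Φ.eval q w ≠ 0) ∧
    ∃ v : Fin 3 → ℂ × ℂ, (∀ i, Φ.eval q (v i) = 0) ∧ ∀ i j, i ≠ j → det2 (v i) (v j) ≠ 0

/-- Near `q` there is a local biholomorphism `h` mapping the solutions to three families of
parallel lines: `Dh` carries the root directions at each point near `q` exactly to three fixed
pairwise distinct directions `ℓ 0, ℓ 1, ℓ 2`. -/
def IsFlatAt (Φ : BinaryCubic) (q : ℂ × ℂ) : Prop :=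
  ∃ (h : ℂ × ℂ → ℂ × ℂ) (ℓ : Fin 3 → ℂ × ℂ),
    AnalyticAt ℂ h q ∧ (fderiv ℂ h q).IsInvertible ∧
    (∀ i j, i ≠ j → det2 (ℓ i) (ℓ j) ≠ 0) ∧
    ∀ᶠ q' in 𝓝 q, ∀ v : ℂ × ℂ, Φ.eval q' v = 0 ↔ ∃ i, det2 (ℓ i) (fderiv ℂ h q' v) = 0

/-- The germ at the origin has a flat (hexagonal) web of solutions: points with three distinct
directions exist arbitrarily close to the origin, and the web is flat at all of them. -/
def IsFlat (Φ : BinaryCubic) : Prop :=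
  (∃ᶠ q in 𝓝 (0 : ℂ × ℂ), Φ.IsRegularAt q) ∧
    ∀ᶠ q in 𝓝 (0 : ℂ × ℂ), Φ.IsRegularAt q → Φ.IsFlatAt q

/-- The time-`t` map of the flow of the Euler field `w_x x ∂_x + w_y y ∂_y`. It is linear, so it
is also its own derivative. -/
def eulerFlow (wx wy t : ℂ) (q : ℂ × ℂ) : ℂ × ℂ :=
  (Complex.exp (t * wx) * q.1, Complex.exp (t * wy) * q.2)

/-- The web of solutions is invariant under the local flow of the non-trivial Euler field with
weights `w_x, w_y`: wherever the web is defined, the flow maps web directions to web directions. -/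
def IsWeightedHomogeneous (Φ : BinaryCubic) (wx wy : ℂ) : Prop :=
  (wx ≠ 0 ∨ wy ≠ 0) ∧
    ∀ᶠ z : ℂ × (ℂ × ℂ) in 𝓝 (0 : ℂ × (ℂ × ℂ)), Φ.IsRegularAt z.2 →
      ∀ v, Φ.eval z.2 v = 0 → Φ.eval (eulerFlow wx wy z.1 z.2) (eulerFlow wx wy z.1 v) = 0

/-- Equivalence of (germs of) equations: a biholomorphism germ `h` fixing the origin pulls `Ψ`
back to `Φ`, up to multiplication by a non-vanishing holomorphic germ `u`. -/
def Equivalent (Φ Ψ : BinaryCubic) : Prop :=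
  ∃ (h : ℂ × ℂ → ℂ × ℂ) (u : ℂ × ℂ → ℂ),
    AnalyticAt ℂ h 0 ∧ h 0 = 0 ∧ (fderiv ℂ h 0).IsInvertible ∧ AnalyticAt ℂ u 0 ∧ u 0 ≠ 0 ∧
    ∀ᶠ q in 𝓝 (0 : ℂ × ℂ), ∀ v : ℂ × ℂ, Ψ.eval (h q) (fderiv ℂ h q v) = u q * Φ.eval q v

/-- `p³ = x^N y³`. -/
def form1 (N : ℕ) : BinaryCubic where
  K₀ := fun q => -(q.1 ^ N * q.2 ^ 3)
  K₁ := fun _ => 0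
  K₂ := fun _ => 0
  K₃ := fun _ => 1

/-- `c` is the holomorphic germ `(2/√27) x^(3N/2) tan(L₀ x^(1+N/2) + L₁)`. Half-integer powers
are read through `x = s²`, and the identity is required for both square roots `s` of `x`. -/
def IsTanCoeff (N : ℕ) (L₀ L₁ : ℂ) (c : ℂ → ℂ) : Prop :=
  AnalyticAt ℂ c 0 ∧
    ∀ᶠ s in 𝓝[≠] (0 : ℂ),
      c (s ^ 2) = 2 / (Real.sqrt 27 : ℂ) * s ^ (3 * N) * Complex.tan (L₀ * s ^ (N + 2) + L₁)

/-- `p³ + x^N y² p = c(x) y³`. -/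
def form2 (N : ℕ) (c : ℂ → ℂ) : BinaryCubic where
  K₀ := fun q => -(c q.1 * q.2 ^ 3)
  K₁ := fun q => q.1 ^ N * q.2 ^ 2
  K₂ := fun _ => 0
  K₃ := fun _ => 1

/-- `c` is the holomorphic germ `2 x^(3(N+1)/2) / (√27 tan(L₀ x^(1+(N+1)/2)))`, with the
singularity at `x = 0` removed; half-integer powers are read through `x = s²`, for both square
roots `s` of `x`. -/
def IsCotCoeff (N : ℕ) (L₀ : ℂ) (c : ℂ → ℂ) : Prop :=
  AnalyticAt ℂ c 0 ∧
    ∀ᶠ s in 𝓝[≠] (0 : ℂ),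
      c (s ^ 2) = 2 * s ^ (3 * (N + 1)) / ((Real.sqrt 27 : ℂ) * Complex.tan (L₀ * s ^ (N + 3)))

/-- `p³ + x^(N+1) y² p + c(x) y³ = 0`. -/
def form3 (N : ℕ) (c : ℂ → ℂ) : BinaryCubic where
  K₀ := fun q => c q.1 * q.2 ^ 3
  K₁ := fun q => q.1 ^ (N + 1) * q.2 ^ 2
  K₂ := fun _ => 0
  K₃ := fun _ => 1

/-- `p (x² y^N p² + 1) = 0`. -/
def form4 (N : ℕ) : BinaryCubic where
  K₀ := fun _ => 0
  K₁ := fun _ => 1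
  K₂ := fun _ => 0
  K₃ := fun q => q.1 ^ 2 * q.2 ^ N

end BinaryCubic

end

/-!
Exchanging the coordinates if necessary, the web is invariant under `(x, y) ↦ (x, λ y)`. Comparing
the cubic with its pull-back at regular points, where a cubic is determined by its three roots up
to a factor, shows that each quotient `R = K_i / K_j` with `K_j(0) ≠ 0` satisfies Euler's equation
`y R_y = (j - i) R`; so `R` is `y^(j-i)` times a function of `x`, and vanishes if `j < i`
(`exists_coeff_eq`, `coeff_eventually_eq_zero`). Since the discriminant is not identically zero,
only two shapes remain:
`dy³ + a y dy² dx + b y² dy dx² + c y³ dx³` and `dx (dy² + a y dy dx + b y² dx²)`,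
with `a, b, c` depending on `x` alone. A substitution `y ↦ y e^{A(x)}` removes `a`, after which a
change of the coordinate `x` makes one coefficient a monomial (`exists_coordinate`). This settles
the second shape, which gives `form4`, and the first shape with `b = 0`, which gives `form1`.

In the first shape with `b ≠ 0` flatness enters. Let `dy = y r_i dx` be the three directions and
let `G_i` be first integrals with `∑ G_i = 0`, as provided by the flattening map. Put
`E_i = y ∂G_i/∂y`. The relations `∑ E_i = ∑ r_i E_i = 0` show that the ratios of the `E_i` depend on
`x` only, and the symmetry of second derivatives then shows that the logarithmic derivative
`y ∂_y log E_i` is a constant `Q`, the same for all `i` (`exists_const_of_first_integrals`). In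
terms of the coefficients with `a` removed this is the differential equation
`2 b c' - 3 c b' = κ (4 b³ + 27 c²)` with `κ` constant (`IsFlatAt.exists_const`). It is proved near
one regular point and continued analytically to the origin.

With `b = x^N` and `T = √27 c / (2 x^(3N/2))`, up to the sign of `c`, this is a Riccati equation
`T' = const x^(N/2) (1 + T²)`, so that `T = tan (L₀ x^(1+N/2) + L₁)`. The tangent is handled
through the relation `A cos θ = B sin θ` (`TanRelation`), which makes sense at its poles. If
`cos L₁ ≠ 0` this is `form2`; if `cos L₁ = 0` the tangent turns into a cotangent and this is `form3`. The phase is normalized by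
comparing the two square roots of `x` and by rotating `x` (`exists_normalForm`).
-/

/-! ### Binary cubic forms with three distinct roots -/

/-- A binary cubic form vanishing on three pairwise independent vectors is a multiple of the
product of the three linear forms that vanish on them; read off coefficient by coefficient. -/
theorem exists_coeff_eq_of_three_roots (k₀ k₁ k₂ k₃ : ℂ) (a b c : ℂ × ℂ)
    (ha : k₃ * a.2 ^ 3 + k₂ * a.2 ^ 2 * a.1 + k₁ * a.2 * a.1 ^ 2 + k₀ * a.1 ^ 3 = 0)
    (hb : k₃ * b.2 ^ 3 + k₂ * b.2 ^ 2 * b.1 + k₁ * b.2 * b.1 ^ 2 + k₀ * b.1 ^ 3 = 0)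
    (hc : k₃ * c.2 ^ 3 + k₂ * c.2 ^ 2 * c.1 + k₁ * c.2 * c.1 ^ 2 + k₀ * c.1 ^ 3 = 0)
    (hab : det2 a b ≠ 0) (hac : det2 a c ≠ 0) (hbc : det2 b c ≠ 0) :
    ∃ μ : ℂ, k₃ = μ * (a.1 * b.1 * c.1) ∧
      k₂ = -μ * (a.1 * b.1 * c.2 + a.1 * b.2 * c.1 + a.2 * b.1 * c.1) ∧
      k₁ = μ * (a.1 * b.2 * c.2 + a.2 * b.1 * c.2 + a.2 * b.2 * c.1) ∧
      k₀ = -μ * (a.2 * b.2 * c.2) := by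
  obtain ⟨a1, a2⟩ := a
  obtain ⟨b1, b2⟩ := b
  obtain ⟨c1, c2⟩ := c
  simp only [det2] at *
  -- the mixed coefficients of the form in the basis `a, b`
  set α := 3 * k₃ * a2 ^ 2 * b2 + k₂ * (a2 ^ 2 * b1 + 2 * a2 * b2 * a1) +
    k₁ * (b2 * a1 ^ 2 + 2 * a2 * a1 * b1) + 3 * k₀ * a1 ^ 2 * b1 with hα
  set β := 3 * k₃ * a2 * b2 ^ 2 + k₂ * (b2 ^ 2 * a1 + 2 * a2 * b2 * b1) +
    k₁ * (a2 * b1 ^ 2 + 2 * b2 * a1 * b1) + 3 * k₀ * a1 * b1 ^ 2 with hβ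
  have key : ∀ x y : ℂ, (a1 * b2 - a2 * b1) ^ 3 *
      (k₃ * y ^ 3 + k₂ * y ^ 2 * x + k₁ * y * x ^ 2 + k₀ * x ^ 3) =
      (x * b2 - y * b1) * (a1 * y - a2 * x) *
        (α * (x * b2 - y * b1) + β * (a1 * y - a2 * x)) := by
    intro x y
    rw [hα, hβ]
    linear_combination (x * b2 - y * b1) ^ 3 * ha + (a1 * y - a2 * x) ^ 3 * hb
  have h0 : α * (c1 * b2 - c2 * b1) + β * (a1 * c2 - a2 * c1) = 0 := by
    have h := key c1 c2
    rw [hc, mul_zero] at h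
    have h1 : (c1 * b2 - c2 * b1) * (a1 * c2 - a2 * c1) ≠ 0 :=
      mul_ne_zero (fun h => hbc (by linear_combination -h)) hac
    exact (mul_eq_zero.mp h.symm).resolve_left h1
  obtain ⟨ν, hν1, hν2⟩ : ∃ ν, α = ν * (a1 * c2 - a2 * c1) ∧ β = ν * (b1 * c2 - b2 * c1) := by
    refine ⟨α / (a1 * c2 - a2 * c1), by field_simp, ?_⟩
    field_simp
    linear_combination h0
  have key2 : ∀ x y : ℂ,
      (k₃ * y ^ 3 + k₂ * y ^ 2 * x + k₁ * y * x ^ 2 + k₀ * x ^ 3) =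
      ν / (a1 * b2 - a2 * b1) ^ 2 * ((a1 * y - a2 * x) * (b1 * y - b2 * x) *
        (c1 * y - c2 * x)) := by
    intro x y
    apply mul_left_cancel₀ (pow_ne_zero 3 hab)
    rw [key, hν1, hν2]
    field_simp
    ring
  refine ⟨ν / (a1 * b2 - a2 * b1) ^ 2, ?_, ?_, ?_, ?_⟩
  · linear_combination key2 0 1
  · linear_combination (1 / 2) * key2 1 1 - (1 / 2) * key2 (-1) 1 - key2 1 0
  · linear_combination (1 / 2) * key2 1 1 + (1 / 2) * key2 (-1) 1 - key2 0 1
  · linear_combination key2 1 0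

theorem det2_map (L : (ℂ × ℂ) →L[ℂ] (ℂ × ℂ)) (a b : ℂ × ℂ) :
    det2 (L a) (L b) = det2 (L (1, 0)) (L (0, 1)) * det2 a b := by
  have h : ∀ a : ℂ × ℂ, L a = a.1 • L (1, 0) + a.2 • L (0, 1) := fun a => by
    rw [← map_smul, ← map_smul, ← map_add]
    simp
  rw [h a, h b]
  simp only [det2, Prod.fst_add, Prod.snd_add, Prod.smul_fst, Prod.smul_snd, smul_eq_mul]
  ring

namespace BinaryCubic

/-- The discriminant of the binary cubic form at the point `q`. -/
def disc (Φ : BinaryCubic) (q : ℂ × ℂ) : ℂ :=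
  Φ.K₁ q ^ 2 * Φ.K₂ q ^ 2 - 4 * Φ.K₀ q * Φ.K₂ q ^ 3 - 4 * Φ.K₁ q ^ 3 * Φ.K₃ q +
    18 * Φ.K₀ q * Φ.K₁ q * Φ.K₂ q * Φ.K₃ q - 27 * Φ.K₀ q ^ 2 * Φ.K₃ q ^ 2

theorem IsRegularAt.disc_ne_zero {Φ : BinaryCubic} {q : ℂ × ℂ} (h : Φ.IsRegularAt q) :
    Φ.disc q ≠ 0 := by
  obtain ⟨⟨w, hw⟩, v, hv, hd⟩ := h
  have h01 := hd 0 1 (by decide)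
  have h02 := hd 0 2 (by decide)
  have h12 := hd 1 2 (by decide)
  obtain ⟨μ, h3, h2, h1, h0⟩ := exists_coeff_eq_of_three_roots _ _ _ _ (v 0) (v 1) (v 2) (hv 0)
    (hv 1) (hv 2) h01 h02 h12
  have hμ : μ ≠ 0 := by
    rintro rfl
    exact hw (by simp [eval, h3, h2, h1, h0])
  have : Φ.disc q = μ ^ 4 * (det2 (v 0) (v 1) * det2 (v 0) (v 2) * det2 (v 1) (v 2)) ^ 2 := by
    simp only [disc, det2, h0, h1, h2, h3]
    ring
  rw [this]
  exact mul_ne_zero (pow_ne_zero _ hμ) (pow_ne_zero _ (mul_ne_zero (mul_ne_zero h01 h02) h12))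

/-- At a flat point the equation has three distinct directions, and so it has at all nearby
points: they are the preimages of the three parallel directions. -/
theorem IsFlatAt.eventually_isRegularAt {Φ : BinaryCubic} {q : ℂ × ℂ} (h : Φ.IsFlatAt q) :
    ∀ᶠ q' in 𝓝 q, Φ.IsRegularAt q' := by
  obtain ⟨f, ℓ, hf, hinv, hℓ, hev⟩ := h
  have hcont : ContinuousAt (fderiv ℂ f) q := hf.fderiv.continuousAt
  have hopen : ∀ᶠ q' in 𝓝 q, (fderiv ℂ f q').IsInvertible := by
    obtain ⟨e, he⟩ := hinv
    have := hcont.eventually (he ▸ ContinuousLinearEquiv.nhds e)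
    filter_upwards [this] with q' hq'
    obtain ⟨e', he'⟩ := hq'
    exact ⟨e', he'⟩
  filter_upwards [hopen, hev] with q' h1 h2
  obtain ⟨e, he⟩ := h1
  rw [← he] at h2
  refine ⟨⟨e.symm (det2 (ℓ 1) (ℓ 2) • ℓ 0 + det2 (ℓ 0) (ℓ 2) • ℓ 1), ?_⟩,
    fun i => e.symm (ℓ i), ?_, ?_⟩
  · have h01 := hℓ 0 1 (by decide)
    have h02 := hℓ 0 2 (by decide)
    have h12 := hℓ 1 2 (by decide)
    rw [Ne, h2]
    rintro ⟨i, hi⟩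
    simp only [ContinuousLinearEquiv.coe_coe, ContinuousLinearEquiv.apply_symm_apply] at hi
    obtain rfl | rfl | rfl : i = 0 ∨ i = 1 ∨ i = 2 := by fin_cases i <;> simp
    · refine mul_ne_zero h02 h01 ?_
      simp only [det2, Prod.fst_add, Prod.snd_add, Prod.smul_fst, Prod.smul_snd,
        smul_eq_mul] at hi ⊢
      linear_combination hi
    · refine mul_ne_zero h12 h01 ?_
      simp only [det2, Prod.fst_add, Prod.snd_add, Prod.smul_fst, Prod.smul_snd,
        smul_eq_mul] at hi ⊢
      linear_combination -hi
    · refine mul_ne_zero h12 h02 ?_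
      simp only [det2, Prod.fst_add, Prod.snd_add, Prod.smul_fst, Prod.smul_snd,
        smul_eq_mul] at hi ⊢
      linear_combination (-1 / 2) * hi
  · intro i
    exact (h2 _).2 ⟨i, by simp [det2]; ring⟩
  · intro i j hij h0
    apply hℓ i j hij
    simpa [h0] using det2_map (e : (ℂ × ℂ) →L[ℂ] (ℂ × ℂ)) (e.symm (ℓ i)) (e.symm (ℓ j))

/-! ### Exchange of the coordinates -/

/-- The binary cubic obtained by exchanging the coordinates `x` and `y`. -/
def swap (Φ : BinaryCubic) : BinaryCubic where
  K₀ := fun q => Φ.K₃ q.swap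
  K₁ := fun q => Φ.K₂ q.swap
  K₂ := fun q => Φ.K₁ q.swap
  K₃ := fun q => Φ.K₀ q.swap

theorem eval_swap (Φ : BinaryCubic) (q v : ℂ × ℂ) : Φ.swap.eval q v = Φ.eval q.swap v.swap := by
  simp only [eval, swap, Prod.fst_swap, Prod.snd_swap]
  ring

theorem swap_swap (Φ : BinaryCubic) : Φ.swap.swap = Φ := rfl

end BinaryCubic

theorem tendsto_prodSwap_nhds_zero :
    Tendsto (Prod.swap : ℂ × ℂ → ℂ × ℂ) (𝓝 0) (𝓝 0) :=
  continuous_swap.tendsto' 0 0 rfl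

theorem det2_swap (a b : ℂ × ℂ) : det2 a.swap b.swap = -det2 a b := by
  simp only [det2, Prod.fst_swap, Prod.snd_swap]
  ring

theorem analyticAt_prodSwap (q : ℂ × ℂ) : AnalyticAt ℂ (Prod.swap : ℂ × ℂ → ℂ × ℂ) q :=
  analyticAt_snd.prod analyticAt_fst

theorem AnalyticAt.comp_prodSwap {F : Type*} [NormedAddCommGroup F] [NormedSpace ℂ F]
    {f : ℂ × ℂ → F} {q : ℂ × ℂ} (hf : AnalyticAt ℂ f q.swap) :
    AnalyticAt ℂ (fun z => f z.swap) q :=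
  AnalyticAt.comp (g := f) hf (analyticAt_prodSwap q)

theorem fderiv_comp_prodSwap {h : ℂ × ℂ → ℂ × ℂ} {q : ℂ × ℂ} (hh : AnalyticAt ℂ h q.swap) :
    fderiv ℂ (fun z => h z.swap) q =
      (fderiv ℂ h q.swap).comp (ContinuousLinearEquiv.prodComm ℂ ℂ ℂ : (ℂ × ℂ) →L[ℂ] ℂ × ℂ) := by
  have h1 : HasFDerivAt (Prod.swap : ℂ × ℂ → ℂ × ℂ)
      (ContinuousLinearEquiv.prodComm ℂ ℂ ℂ : (ℂ × ℂ) →L[ℂ] ℂ × ℂ) q :=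
    (ContinuousLinearEquiv.prodComm ℂ ℂ ℂ).hasFDerivAt
  exact (hh.differentiableAt.hasFDerivAt.comp q h1).fderiv

namespace BinaryCubic

theorem isRegularAt_swap {Φ : BinaryCubic} {q : ℂ × ℂ} (h : Φ.IsRegularAt q) :
    Φ.swap.IsRegularAt q.swap := by
  obtain ⟨⟨w, hw⟩, v, hv, hd⟩ := h
  refine ⟨⟨w.swap, by simpa [eval_swap] using hw⟩, fun i => (v i).swap,
    fun i => by simpa [eval_swap] using hv i, fun i j hij => ?_⟩
  rw [det2_swap]
  exact neg_ne_zero.2 (hd i j hij)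

theorem isFlatAt_swap {Φ : BinaryCubic} {q : ℂ × ℂ} (h : Φ.IsFlatAt q) :
    Φ.swap.IsFlatAt q.swap := by
  obtain ⟨f, ℓ, hf, hinv, hℓ, hev⟩ := h
  refine ⟨fun z => f z.swap, ℓ, ?_, ?_, hℓ, ?_⟩
  · exact AnalyticAt.comp_prodSwap (by simpa using hf)
  · rw [fderiv_comp_prodSwap (by simpa using hf)]
    rw [Prod.swap_swap]
    obtain ⟨e, he⟩ := hinv
    exact ⟨(ContinuousLinearEquiv.prodComm ℂ ℂ ℂ).trans e, by rw [← he]; rfl⟩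
  · have ht : Tendsto (Prod.swap : ℂ × ℂ → ℂ × ℂ) (𝓝 q.swap) (𝓝 q) :=
      continuous_swap.tendsto' _ _ (by simp)
    filter_upwards [ht.eventually hev, ht.eventually hf.eventually_analyticAt] with z hz hz'
    intro v
    rw [eval_swap, hz, fderiv_comp_prodSwap hz']
    rfl

theorem isFlat_swap {Φ : BinaryCubic} (h : Φ.IsFlat) : Φ.swap.IsFlat := by
  refine ⟨tendsto_prodSwap_nhds_zero.frequently (h.1.mono fun q hq => isRegularAt_swap hq), ?_⟩
  filter_upwards [tendsto_prodSwap_nhds_zero.eventually h.2] with q hq hr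
  simpa using isFlatAt_swap (hq (by simpa [swap_swap] using isRegularAt_swap hr))

theorem isHolomorphicGerm_swap {Φ : BinaryCubic} (h : Φ.IsHolomorphicGerm) :
    Φ.swap.IsHolomorphicGerm := by
  obtain ⟨h0, h1, h2, h3, hne⟩ := h
  refine ⟨h3.comp_prodSwap (q := 0), h2.comp_prodSwap (q := 0), h1.comp_prodSwap (q := 0),
    h0.comp_prodSwap (q := 0), ?_⟩
  change Φ.K₃ 0 ≠ 0 ∨ Φ.K₂ 0 ≠ 0 ∨ Φ.K₁ 0 ≠ 0 ∨ Φ.K₀ 0 ≠ 0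
  tauto

theorem swap_eulerFlow (wx wy t : ℂ) (q : ℂ × ℂ) :
    (eulerFlow wx wy t q).swap = eulerFlow wy wx t q.swap := rfl

theorem isWeightedHomogeneous_swap {Φ : BinaryCubic} {wx wy : ℂ}
    (h : Φ.IsWeightedHomogeneous wx wy) : Φ.swap.IsWeightedHomogeneous wy wx := by
  refine ⟨h.1.symm, ?_⟩
  have ht : Tendsto (fun z : ℂ × (ℂ × ℂ) => (z.1, z.2.swap)) (𝓝 0) (𝓝 0) := by
    have hc : Continuous (fun z : ℂ × (ℂ × ℂ) => (z.1, z.2.swap)) := by fun_prop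
    exact hc.tendsto' _ _ (by simp)
  filter_upwards [ht.eventually h.2] with z hz hr v hv
  rw [eval_swap] at hv ⊢
  rw [swap_eulerFlow, swap_eulerFlow]
  exact hz (by simpa only [swap_swap] using isRegularAt_swap hr) _ hv

theorem Equivalent.swap_left {Φ Ψ : BinaryCubic} (h : Φ.Equivalent Ψ) :
    Φ.swap.Equivalent Ψ := by
  obtain ⟨f, u, hf, hf0, hinv, hu, hu0, hev⟩ := h
  refine ⟨fun z => f z.swap, fun z => u z.swap, ?_, hf0, ?_, ?_, hu0, ?_⟩
  · exact hf.comp_prodSwap (q := 0)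
  · rw [fderiv_comp_prodSwap hf]
    obtain ⟨e, he⟩ := hinv
    exact ⟨(ContinuousLinearEquiv.prodComm ℂ ℂ ℂ).trans e, by
      change _ = (fderiv ℂ f 0).comp _
      rw [← he]; rfl⟩
  · exact hu.comp_prodSwap (q := 0)
  · filter_upwards [tendsto_prodSwap_nhds_zero.eventually hev,
      tendsto_prodSwap_nhds_zero.eventually hf.eventually_analyticAt] with z hz hz' v
    rw [eval_swap, ← hz, fderiv_comp_prodSwap hz']
    rfl

theorem Equivalent.swap_right {Φ Ψ : BinaryCubic} (h : Φ.Equivalent Ψ) :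
    Φ.Equivalent Ψ.swap := by
  obtain ⟨f, u, hf, hf0, hinv, hu, hu0, hev⟩ := h
  have hd : ∀ q, AnalyticAt ℂ f q → fderiv ℂ (fun z => (f z).swap) q =
      (ContinuousLinearEquiv.prodComm ℂ ℂ ℂ : (ℂ × ℂ) →L[ℂ] ℂ × ℂ).comp (fderiv ℂ f q) := by
    intro q hq
    have h1 : HasFDerivAt (Prod.swap : ℂ × ℂ → ℂ × ℂ)
        (ContinuousLinearEquiv.prodComm ℂ ℂ ℂ : (ℂ × ℂ) →L[ℂ] ℂ × ℂ) (f q) :=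
      (ContinuousLinearEquiv.prodComm ℂ ℂ ℂ).hasFDerivAt
    exact (h1.comp q hq.differentiableAt.hasFDerivAt).fderiv
  refine ⟨fun z => (f z).swap, u, (analyticAt_prodSwap _).comp hf, by simp [hf0], ?_, hu, hu0, ?_⟩
  · rw [hd 0 hf]
    obtain ⟨e, he⟩ := hinv
    exact ⟨e.trans (ContinuousLinearEquiv.prodComm ℂ ℂ ℂ), by rw [← he]; rfl⟩
  · filter_upwards [hev, hf.eventually_analyticAt] with z hz hz' v
    rw [← hz, eval_swap, hd z hz']
    rfl

end BinaryCubic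

/-! ### Euler's differential equation in the variable `y` -/

/-- The partial derivative `∂F/∂x`. -/
noncomputable def dx (F : ℂ × ℂ → ℂ) (q : ℂ × ℂ) : ℂ := fderiv ℂ F q (1, 0)

/-- The partial derivative `∂F/∂y`. -/
noncomputable def dy (F : ℂ × ℂ → ℂ) (q : ℂ × ℂ) : ℂ := fderiv ℂ F q (0, 1)

theorem analyticAt_dx {F : ℂ × ℂ → ℂ} {q : ℂ × ℂ} (hF : AnalyticAt ℂ F q) :
    AnalyticAt ℂ (dx F) q :=
  (ContinuousLinearMap.apply ℂ ℂ ((1, 0) : ℂ × ℂ)).analyticAt _ |>.comp hF.fderiv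

theorem analyticAt_dy {F : ℂ × ℂ → ℂ} {q : ℂ × ℂ} (hF : AnalyticAt ℂ F q) :
    AnalyticAt ℂ (dy F) q :=
  (ContinuousLinearMap.apply ℂ ℂ ((0, 1) : ℂ × ℂ)).analyticAt _ |>.comp hF.fderiv

theorem dy_congr {F G : ℂ × ℂ → ℂ} {q : ℂ × ℂ} (h : F =ᶠ[𝓝 q] G) : dy F q = dy G q := by
  rw [dy, dy, h.fderiv_eq]

theorem dx_congr {F G : ℂ × ℂ → ℂ} {q : ℂ × ℂ} (h : F =ᶠ[𝓝 q] G) : dx F q = dx G q := by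
  rw [dx, dx, h.fderiv_eq]

theorem dy_mul {F G : ℂ × ℂ → ℂ} {q : ℂ × ℂ} (hF : AnalyticAt ℂ F q) (hG : AnalyticAt ℂ G q) :
    dy (fun z => F z * G z) q = F q * dy G q + dy F q * G q := by
  have h := hF.differentiableAt.hasFDerivAt.mul hG.differentiableAt.hasFDerivAt
  have h' : fderiv ℂ (fun z => F z * G z) q = _ := h.fderiv
  rw [dy, h', dy, dy]
  simp [mul_comm]

theorem dx_mul {F G : ℂ × ℂ → ℂ} {q : ℂ × ℂ} (hF : AnalyticAt ℂ F q) (hG : AnalyticAt ℂ G q) :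
    dx (fun z => F z * G z) q = F q * dx G q + dx F q * G q := by
  have h := hF.differentiableAt.hasFDerivAt.mul hG.differentiableAt.hasFDerivAt
  have h' : fderiv ℂ (fun z => F z * G z) q = _ := h.fderiv
  rw [dx, h', dx, dx]
  simp [mul_comm]

theorem dy_snd (q : ℂ × ℂ) : dy Prod.snd q = 1 := by simp [dy, fderiv_snd]

theorem dx_snd (q : ℂ × ℂ) : dx Prod.snd q = 0 := by simp [dx, fderiv_snd]

theorem dy_const_mul (c : ℂ) {F : ℂ × ℂ → ℂ} {q : ℂ × ℂ} (hF : AnalyticAt ℂ F q) :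
    dy (fun z => c * F z) q = c * dy F q := by
  have h := (hF.differentiableAt.hasFDerivAt.const_mul c).fderiv
  rw [dy, h, dy]
  simp

theorem dx_const_mul (c : ℂ) {F : ℂ × ℂ → ℂ} {q : ℂ × ℂ} (hF : AnalyticAt ℂ F q) :
    dx (fun z => c * F z) q = c * dx F q := by
  have h := (hF.differentiableAt.hasFDerivAt.const_mul c).fderiv
  rw [dx, h, dx]
  simp

theorem hasDerivAt_slice {F : ℂ × ℂ → ℂ} {x y : ℂ} (hF : AnalyticAt ℂ F (x, y)) :
    HasDerivAt (fun t => F (x, t)) (dy F (x, y)) y :=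
  hF.differentiableAt.hasFDerivAt.comp_hasDerivAt y
    ((hasDerivAt_const y x).prodMk (hasDerivAt_id y))

/-- A function whose `y`-derivative vanishes near the origin depends on `x` only. -/
theorem eventually_eq_of_dy_eq_zero {F : ℂ × ℂ → ℂ} (hF : AnalyticAt ℂ F 0)
    (h : ∀ᶠ q in 𝓝 (0 : ℂ × ℂ), dy F q = 0) : ∀ᶠ q in 𝓝 (0 : ℂ × ℂ), F q = F (q.1, 0) := by
  obtain ⟨ρ, hρ, hball⟩ := Metric.eventually_nhds_iff_ball.1 (h.and hF.eventually_analyticAt)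
  refine Metric.eventually_nhds_iff_ball.2 ⟨ρ, hρ, fun q hq => ?_⟩
  obtain ⟨x, y⟩ := q
  have hmem : ∀ t ∈ Metric.ball (0 : ℂ) ρ, (x, t) ∈ Metric.ball (0 : ℂ × ℂ) ρ := by
    intro t ht
    simp only [mem_ball_zero_iff, Prod.norm_def, max_lt_iff] at hq ht ⊢
    exact ⟨hq.1, ht⟩
  have hd : ∀ t ∈ Metric.ball (0 : ℂ) ρ, HasDerivAt (fun t => F (x, t)) 0 t := by
    intro t ht
    have := hball _ (hmem t ht)
    simpa [this.1] using hasDerivAt_slice this.2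
  have hy : y ∈ Metric.ball (0 : ℂ) ρ := by
    simp only [mem_ball_zero_iff, Prod.norm_def, max_lt_iff] at hq ⊢
    exact hq.2
  exact Metric.isOpen_ball.is_const_of_deriv_eq_zero (convex_ball 0 ρ).isPreconnected
    (fun t ht => (hd t ht).differentiableAt.differentiableWithinAt) (fun t ht => (hd t ht).deriv)
    hy (Metric.mem_ball_self hρ)

theorem eventually_dy_snd_mul {F : ℂ × ℂ → ℂ} (hF : AnalyticAt ℂ F 0) :
    ∀ᶠ q in 𝓝 (0 : ℂ × ℂ), dy (fun z => z.2 * F z) q = q.2 * dy F q + F q := by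
  filter_upwards [hF.eventually_analyticAt] with q hq
  rw [dy_mul (F := Prod.snd) analyticAt_snd hq, dy_snd, one_mul]

/-- A holomorphic solution of `y R_y = n R` with `n ≥ 0` is `y^n` times a function of `x`. -/
theorem exists_eq_pow_mul_of_euler (n : ℕ) : ∀ {R : ℂ × ℂ → ℂ}, AnalyticAt ℂ R 0 →
    (∀ᶠ q in 𝓝 (0 : ℂ × ℂ), q.2 * dy R q = n * R q) →
    ∃ f : ℂ → ℂ, AnalyticAt ℂ f 0 ∧ ∀ᶠ q in 𝓝 (0 : ℂ × ℂ), R q = q.2 ^ n * f q.1 := by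
  induction n with
  | zero =>
    intro R hR h
    refine ⟨fun x => R (x, 0), ?_, ?_⟩
    · exact AnalyticAt.comp (g := R) (f := fun x => (x, 0)) (x := 0) hR (by fun_prop)
    · have h1 : ∀ᶠ q in 𝓝 (0 : ℂ × ℂ), dy R q = 0 := by
        filter_upwards [eventually_dy_snd_mul (analyticAt_dy hR), h.eventually_nhds, h]
          with q h1 h2 h3
        have h4 : dy (fun z => z.2 * dy R z) q = 0 := by
          rw [dy_congr (G := fun _ => (0 : ℂ)) (h2.mono fun z hz => by simpa using hz)]
          simp [dy]
        rcases eq_or_ne q.2 0 with h5 | h5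
        · rw [h4, h5, zero_mul, zero_add] at h1
          exact h1.symm
        · simpa [h5] using h3
      simpa using eventually_eq_of_dy_eq_zero hR h1
  | succ n ih =>
    intro R hR h
    obtain ⟨f, hf, hev⟩ := ih (analyticAt_dy hR) (by
      filter_upwards [eventually_dy_snd_mul (analyticAt_dy hR), h.eventually_nhds,
        hR.eventually_analyticAt] with q h1 h2 h3
      rw [dy_congr (h2.mono fun z hz => hz), dy_const_mul _ h3] at h1
      push_cast at h1
      linear_combination -h1)
    refine ⟨fun x => f x / (n + 1), by fun_prop, ?_⟩
    filter_upwards [h, hev] with q h1 h2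
    have hn : (n : ℂ) + 1 ≠ 0 := by exact_mod_cast n.succ_ne_zero
    rw [h2] at h1
    push_cast at h1
    field_simp
    linear_combination -h1

/-- A holomorphic solution of `y R_y = -m R` with `m > 0` vanishes. -/
theorem eventually_eq_zero_of_euler {m : ℕ} (hm : m ≠ 0) {R : ℂ × ℂ → ℂ} (hR : AnalyticAt ℂ R 0)
    (h : ∀ᶠ q in 𝓝 (0 : ℂ × ℂ), q.2 * dy R q = -m * R q) : ∀ᶠ q in 𝓝 (0 : ℂ × ℂ), R q = 0 := by
  obtain ⟨k, rfl⟩ := Nat.exists_eq_succ_of_ne_zero hm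
  have hF : AnalyticAt ℂ (fun q : ℂ × ℂ => q.2 ^ (k + 1) * R q) 0 :=
    (analyticAt_snd.pow _).mul hR
  have h1 := eventually_eq_of_dy_eq_zero hF (by
    filter_upwards [h, hR.eventually_analyticAt] with q hq hq'
    rw [dy_mul (F := fun q => q.2 ^ (k + 1)) (analyticAt_snd.pow _) hq']
    have : dy (fun q => q.2 ^ (k + 1)) q = (k + 1) * q.2 ^ k := by
      have := (hasFDerivAt_snd (𝕜 := ℂ) (p := q) (E := ℂ) (F := ℂ)).pow (k + 1)
      have h' : fderiv ℂ (fun q : ℂ × ℂ => q.2 ^ (k + 1)) q = _ := this.fderiv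
      rw [dy, h']
      simp
    rw [this]
    push_cast at hq
    linear_combination q.2 ^ k * hq)
  filter_upwards [h, h1] with q hq hq'
  rcases eq_or_ne q.2 0 with h5 | h5
  · rw [h5, zero_mul] at hq
    have : ((k.succ : ℕ) : ℂ) ≠ 0 := Nat.cast_ne_zero.2 k.succ_ne_zero
    exact (mul_eq_zero.1 hq.symm).resolve_left (neg_ne_zero.2 this)
  · simpa [h5] using hq'

/-! ### Invariance under scaling of `y` -/

/-- Two binary cubic forms with three common distinct roots are proportional. -/
theorem mul_coeff_comm_of_three_roots (k k' : Fin 4 → ℂ) (v : Fin 3 → ℂ × ℂ)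
    (hv : ∀ i, k 3 * (v i).2 ^ 3 + k 2 * (v i).2 ^ 2 * (v i).1 + k 1 * (v i).2 * (v i).1 ^ 2 +
      k 0 * (v i).1 ^ 3 = 0)
    (hv' : ∀ i, k' 3 * (v i).2 ^ 3 + k' 2 * (v i).2 ^ 2 * (v i).1 +
      k' 1 * (v i).2 * (v i).1 ^ 2 + k' 0 * (v i).1 ^ 3 = 0)
    (hd : ∀ i j, i ≠ j → det2 (v i) (v j) ≠ 0) (i j : Fin 4) : k i * k' j = k j * k' i := by
  have h01 := hd 0 1 (by decide)
  have h02 := hd 0 2 (by decide)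
  have h12 := hd 1 2 (by decide)
  obtain ⟨μ, h3, h2, h1, h0⟩ := exists_coeff_eq_of_three_roots _ _ _ _ _ _ _ (hv 0) (hv 1) (hv 2)
    h01 h02 h12
  obtain ⟨μ', h3', h2', h1', h0'⟩ := exists_coeff_eq_of_three_roots _ _ _ _ _ _ _ (hv' 0) (hv' 1)
    (hv' 2) h01 h02 h12
  obtain ⟨P, hP, hP'⟩ : ∃ P : Fin 4 → ℂ, (∀ i, k i = μ * P i) ∧ (∀ i, k' i = μ' * P i) := by
    refine ⟨![-((v 0).2 * (v 1).2 * (v 2).2), (v 0).1 * (v 1).2 * (v 2).2 +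
      (v 0).2 * (v 1).1 * (v 2).2 + (v 0).2 * (v 1).2 * (v 2).1, -((v 0).1 * (v 1).1 * (v 2).2 +
      (v 0).1 * (v 1).2 * (v 2).1 + (v 0).2 * (v 1).1 * (v 2).1), (v 0).1 * (v 1).1 * (v 2).1],
      fun i => ?_, fun i => ?_⟩ <;> fin_cases i <;>
      simp [h0, h1, h2, h3, h0', h1', h2', h3'] <;> ring
  rw [hP, hP, hP', hP']
  ring

namespace BinaryCubic

/-- The coefficients of a binary cubic as a family indexed by the exponent of `dy`. -/
def coeff (Φ : BinaryCubic) : Fin 4 → ℂ × ℂ → ℂ := ![Φ.K₀, Φ.K₁, Φ.K₂, Φ.K₃]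

theorem IsHolomorphicGerm.analyticAt_coeff {Φ : BinaryCubic} (h : Φ.IsHolomorphicGerm)
    (i : Fin 4) : AnalyticAt ℂ (Φ.coeff i) 0 := by
  obtain ⟨h0, h1, h2, h3, -⟩ := h
  fin_cases i <;> assumption

/-- The set of regular points is a uniqueness set for holomorphic functions near the origin: it
contains an open set in every neighbourhood. -/
theorem IsFlat.eventually_eq_zero {Φ : BinaryCubic} (hflat : Φ.IsFlat)
    {F : ℂ → ℂ × ℂ → ℂ} (hF : ∀ᶠ z : ℂ × (ℂ × ℂ) in 𝓝 0, AnalyticAt ℂ (F z.1) z.2)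
    (h : ∀ᶠ z : ℂ × (ℂ × ℂ) in 𝓝 0, Φ.IsRegularAt z.2 → F z.1 z.2 = 0) :
    ∀ᶠ z : ℂ × (ℂ × ℂ) in 𝓝 0, F z.1 z.2 = 0 := by
  obtain ⟨ρ, hρ, hball⟩ := Metric.eventually_nhds_iff_ball.1 (h.and hF)
  have hmem : ∀ t q, t ∈ Metric.ball (0 : ℂ) ρ → q ∈ Metric.ball (0 : ℂ × ℂ) ρ →
      (t, q) ∈ Metric.ball (0 : ℂ × (ℂ × ℂ)) ρ := by
    intro t q ht hq
    rw [mem_ball_zero_iff] at *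
    exact max_lt ht hq
  obtain ⟨q₀, ⟨hq₀, hflat₀⟩, hq₀ρ⟩ := ((hflat.1.and_eventually hflat.2).and_eventually
    (Metric.ball_mem_nhds (0 : ℂ × ℂ) hρ)).exists
  refine Metric.eventually_nhds_iff_ball.2 ⟨ρ, hρ, fun z hz => ?_⟩
  obtain ⟨t, q⟩ := z
  have ht : t ∈ Metric.ball (0 : ℂ) ρ := by
    rw [mem_ball_zero_iff] at *
    exact lt_of_le_of_lt (le_max_left _ _) hz
  have hq : q ∈ Metric.ball (0 : ℂ × ℂ) ρ := by
    rw [mem_ball_zero_iff] at *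
    exact lt_of_le_of_lt (le_max_right _ _) hz
  have han : AnalyticOnNhd ℂ (F t) (Metric.ball (0 : ℂ × ℂ) ρ) :=
    fun q hq => (hball _ (hmem t q ht hq)).2
  refine han.eqOn_zero_of_preconnected_of_eventuallyEq_zero
    (convex_ball 0 ρ).isPreconnected hq₀ρ ?_ hq
  filter_upwards [(hflat₀ hq₀).eventually_isRegularAt, Metric.isOpen_ball.mem_nhds hq₀ρ]
    with q' h1 h2
  exact (hball _ (hmem t q' ht h2)).1 h1

theorem continuous_eulerFlow (w : ℂ) :
    Continuous (fun z : ℂ × (ℂ × ℂ) => eulerFlow 0 w z.1 z.2) := by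
  unfold eulerFlow
  fun_prop

theorem eulerFlow_zero_right (wx wy t : ℂ) : eulerFlow wx wy t 0 = 0 := by simp [eulerFlow]

/-- Invariance of the web under `y ↦ λ y` makes the pulled back coefficients proportional to the
original ones. -/
theorem eventually_mul_coeff_comm {Φ : BinaryCubic} (hΦ : Φ.IsHolomorphicGerm)
    (hflat : Φ.IsFlat) {w : ℂ} (hhom : Φ.IsWeightedHomogeneous 0 w) (i j : Fin 4) :
    ∀ᶠ z : ℂ × (ℂ × ℂ) in 𝓝 0,
      Complex.exp (z.1 * w) ^ (i : ℕ) * Φ.coeff i (eulerFlow 0 w z.1 z.2) * Φ.coeff j z.2 -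
      Complex.exp (z.1 * w) ^ (j : ℕ) * Φ.coeff j (eulerFlow 0 w z.1 z.2) * Φ.coeff i z.2 = 0 := by
  have hflow : Tendsto (fun z : ℂ × (ℂ × ℂ) => eulerFlow 0 w z.1 z.2) (𝓝 0) (𝓝 0) :=
    (continuous_eulerFlow w).tendsto' _ _ (eulerFlow_zero_right _ _ _)
  have hsnd : Tendsto (fun z : ℂ × (ℂ × ℂ) => z.2) (𝓝 0) (𝓝 0) := continuous_snd.tendsto' _ _ rfl
  refine hflat.eventually_eq_zero (F := fun t q =>
    Complex.exp (t * w) ^ (i : ℕ) * Φ.coeff i (eulerFlow 0 w t q) * Φ.coeff j q -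
    Complex.exp (t * w) ^ (j : ℕ) * Φ.coeff j (eulerFlow 0 w t q) * Φ.coeff i q) ?_ ?_
  · filter_upwards [hflow.eventually (hΦ.analyticAt_coeff i).eventually_analyticAt,
      hflow.eventually (hΦ.analyticAt_coeff j).eventually_analyticAt,
      hsnd.eventually (hΦ.analyticAt_coeff i).eventually_analyticAt,
      hsnd.eventually (hΦ.analyticAt_coeff j).eventually_analyticAt] with z h1 h2 h3 h4
    have hfl : AnalyticAt ℂ (eulerFlow 0 w z.1) z.2 :=
      (analyticAt_const.mul analyticAt_fst).prod (analyticAt_const.mul analyticAt_snd)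
    exact ((analyticAt_const.mul (h1.comp hfl)).mul h4).sub
      ((analyticAt_const.mul (h2.comp hfl)).mul h3)
  · filter_upwards [hhom.2] with z hz hreg
    obtain ⟨v, hv, hd⟩ := hreg.2
    have := mul_coeff_comm_of_three_roots
      (fun i => Complex.exp (z.1 * w) ^ (i : ℕ) * Φ.coeff i (eulerFlow 0 w z.1 z.2))
      (fun i => Φ.coeff i z.2) v (fun i => ?_) (fun i => hv i) hd i j
    · exact sub_eq_zero.2 this
    · have h := hz hreg (v i) (hv i)
      have e1 : (eulerFlow 0 w z.1 (v i)).1 = (v i).1 := by simp [eulerFlow]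
      have e2 : (eulerFlow 0 w z.1 (v i)).2 = Complex.exp (z.1 * w) * (v i).2 := rfl
      rw [eval, e1, e2] at h
      simp only [coeff, Fin.isValue, Matrix.cons_val]
      simp only [Fin.coe_ofNat_eq_mod]
      norm_num
      linear_combination h

/-- Differentiating the invariance relation along the flow at time zero. -/
theorem euler_of_mul_coeff_comm {A B : ℂ × ℂ → ℂ} (hA : AnalyticAt ℂ A 0) (hB : AnalyticAt ℂ B 0)
    (hB0 : B 0 ≠ 0) {w : ℂ} (hw : w ≠ 0) (i j : ℕ)
    (h : ∀ᶠ z : ℂ × (ℂ × ℂ) in 𝓝 0,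
      Complex.exp (z.1 * w) ^ i * A (eulerFlow 0 w z.1 z.2) * B z.2 -
      Complex.exp (z.1 * w) ^ j * B (eulerFlow 0 w z.1 z.2) * A z.2 = 0) :
    ∀ᶠ q in 𝓝 (0 : ℂ × ℂ), q.2 * dy (fun q => A q / B q) q = (j - i) * (A q / B q) := by
  have h' : ∀ᶠ q in 𝓝 (0 : ℂ × ℂ), ∀ᶠ t in 𝓝 (0 : ℂ),
      Complex.exp (t * w) ^ i * A (eulerFlow 0 w t q) * B q -
      Complex.exp (t * w) ^ j * B (eulerFlow 0 w t q) * A q = 0 := by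
    have ht : Tendsto (fun z : (ℂ × ℂ) × ℂ => (z.2, z.1)) (𝓝 0) (𝓝 0) :=
      continuous_swap.tendsto' _ _ rfl
    have := ht.eventually h
    rw [Prod.zero_eq_mk, nhds_prod_eq] at this
    exact this.curry
  filter_upwards [h', hA.eventually_analyticAt, hB.eventually_analyticAt,
    hB.continuousAt.eventually_ne hB0] with q hq hAq hBq hBq0
  have hflow : ∀ {F : ℂ × ℂ → ℂ}, AnalyticAt ℂ F q →
      HasDerivAt (fun t => F (eulerFlow 0 w t q)) (w * q.2 * dy F q) 0 := by
    intro F hF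
    have e0 : eulerFlow 0 w 0 q = q := by simp [eulerFlow]
    have h1 : HasDerivAt (fun t => eulerFlow 0 w t q) ((0 : ℂ), w * q.2) 0 := by
      refine HasDerivAt.prodMk ?_ ?_
      · simpa using hasDerivAt_const (0 : ℂ) q.1
      · have := (((hasDerivAt_id (0 : ℂ)).mul_const w).cexp).mul_const q.2
        simpa using this
    have hF' : HasFDerivAt F (fderiv ℂ F q) (eulerFlow 0 w 0 q) := by
      rw [e0]
      exact hF.differentiableAt.hasFDerivAt
    have := hF'.comp_hasDerivAt (0 : ℂ) h1
    have e : ((0 : ℂ), w * q.2) = (w * q.2) • ((0 : ℂ), (1 : ℂ)) := by simp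
    rw [e, map_smul] at this
    exact this
  have hexp : ∀ n : ℕ, HasDerivAt (fun t => Complex.exp (t * w) ^ n) (n * w) 0 := by
    intro n
    have := (((hasDerivAt_id (0 : ℂ)).mul_const w).cexp).pow n
    simpa [Pi.pow_def] using this
  have hd := (((hexp i).mul (hflow hAq)).mul_const (B q)).sub
    (((hexp j).mul (hflow hBq)).mul_const (A q))
  have h0 := hd.unique ((hasDerivAt_const (0 : ℂ) (0 : ℂ)).congr_of_eventuallyEq hq)
  have e0 : eulerFlow 0 w 0 q = q := by simp [eulerFlow]
  simp only [e0, zero_mul, Complex.exp_zero, one_pow, one_mul] at h0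
  have hR : AnalyticAt ℂ (fun q => A q / B q) q := hAq.div hBq hBq0
  have hAR : dy A q = (A q / B q) * dy B q + dy (fun q => A q / B q) q * B q := by
    rw [← dy_mul hR hBq]
    refine dy_congr ?_
    filter_upwards [hBq.continuousAt.eventually_ne hBq0] with z hz
    field_simp
  rw [hAR] at h0
  have hr : A q = A q / B q * B q := by field_simp
  generalize A q / B q = r at h0 hr ⊢
  rw [hr] at h0
  apply mul_left_cancel₀ (mul_ne_zero hw (pow_ne_zero 2 hBq0))
  linear_combination h0

/-- A web invariant under scaling of `y`: relative to a coefficient that does not vanish at the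
origin, the coefficient of `dy^i` is a power of `y` times a function of `x`. -/
theorem exists_coeff_eq {Φ : BinaryCubic} (hΦ : Φ.IsHolomorphicGerm)
    (hflat : Φ.IsFlat) {w : ℂ} (hw : w ≠ 0) (hhom : Φ.IsWeightedHomogeneous 0 w) {i j : Fin 4}
    (hj : Φ.coeff j 0 ≠ 0) (n : ℕ) (hn : (i : ℕ) + n = j) : ∃ f : ℂ → ℂ, AnalyticAt ℂ f 0 ∧
      ∀ᶠ q in 𝓝 (0 : ℂ × ℂ), Φ.coeff i q = Φ.coeff j q * (q.2 ^ n * f q.1) := by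
  have h := euler_of_mul_coeff_comm (hΦ.analyticAt_coeff i) (hΦ.analyticAt_coeff j) hj hw i j
    (eventually_mul_coeff_comm hΦ hflat hhom i j)
  obtain ⟨f, hf, hev⟩ := exists_eq_pow_mul_of_euler n
    ((hΦ.analyticAt_coeff i).div (hΦ.analyticAt_coeff j) hj) (by
      filter_upwards [h] with q hq
      have : (j : ℂ) - (i : ℂ) = n := by rw [← hn]; push_cast; ring
      rw [← this]
      exact hq)
  refine ⟨f, hf, ?_⟩
  filter_upwards [hev, (hΦ.analyticAt_coeff j).continuousAt.eventually_ne hj] with q hq hq0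
  rw [← hq]
  exact (mul_div_cancel₀ _ hq0).symm

/-- A coefficient of higher exponent in `dy` than one that does not vanish at the origin would have
negative degree in `y`, so it is zero. -/
theorem coeff_eventually_eq_zero {Φ : BinaryCubic} (hΦ : Φ.IsHolomorphicGerm)
    (hflat : Φ.IsFlat) {w : ℂ} (hw : w ≠ 0) (hhom : Φ.IsWeightedHomogeneous 0 w) {i j : Fin 4}
    (hj : Φ.coeff j 0 ≠ 0) (hij : j < i) : ∀ᶠ q in 𝓝 (0 : ℂ × ℂ), Φ.coeff i q = 0 := by
  have h := euler_of_mul_coeff_comm (hΦ.analyticAt_coeff i) (hΦ.analyticAt_coeff j) hj hw i j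
    (eventually_mul_coeff_comm hΦ hflat hhom i j)
  have hlt : (j : ℕ) < i := hij
  have hev := eventually_eq_zero_of_euler (m := i - j) (by omega)
    ((hΦ.analyticAt_coeff i).div (hΦ.analyticAt_coeff j) hj) (by
      filter_upwards [h] with q hq
      rw [Nat.cast_sub hlt.le, neg_sub]
      exact hq)
  filter_upwards [hev, (hΦ.analyticAt_coeff j).continuousAt.eventually_ne hj] with q hq hq0
  exact (div_eq_zero_iff.1 hq).resolve_right hq0

end BinaryCubic

/-! ### Flatness as a differential equation for the coefficients -/

theorem dx_dy_comm {F : ℂ × ℂ → ℂ} {q : ℂ × ℂ} (hF : AnalyticAt ℂ F q) :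
    dx (dy F) q = dy (dx F) q := by
  have hs : IsSymmSndFDerivAt ℂ F q := hF.contDiffAt.isSymmSndFDerivAt (n := ⊤) (by simp)
  have h : ∀ v w : ℂ × ℂ, fderiv ℂ (fun z => fderiv ℂ F z v) q w = fderiv ℂ (fderiv ℂ F) q w v := by
    intro v w
    rw [fderiv_clm_apply hF.fderiv.differentiableAt (differentiableAt_const v)]
    simp
  change fderiv ℂ (fun z => fderiv ℂ F z (0, 1)) q (1, 0) =
    fderiv ℂ (fun z => fderiv ℂ F z (1, 0)) q (0, 1)
  rw [h, h]
  exact hs _ _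

theorem dy_add {F G : ℂ × ℂ → ℂ} {q : ℂ × ℂ} (hF : AnalyticAt ℂ F q) (hG : AnalyticAt ℂ G q) :
    dy (fun z => F z + G z) q = dy F q + dy G q := by
  have h : fderiv ℂ (fun z => F z + G z) q = _ :=
    (hF.differentiableAt.hasFDerivAt.add hG.differentiableAt.hasFDerivAt).fderiv
  rw [dy, h]
  rfl

theorem dx_add {F G : ℂ × ℂ → ℂ} {q : ℂ × ℂ} (hF : AnalyticAt ℂ F q) (hG : AnalyticAt ℂ G q) :
    dx (fun z => F z + G z) q = dx F q + dx G q := by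
  have h : fderiv ℂ (fun z => F z + G z) q = _ :=
    (hF.differentiableAt.hasFDerivAt.add hG.differentiableAt.hasFDerivAt).fderiv
  rw [dx, h]
  rfl

theorem dy_sub {F G : ℂ × ℂ → ℂ} {q : ℂ × ℂ} (hF : AnalyticAt ℂ F q) (hG : AnalyticAt ℂ G q) :
    dy (fun z => F z - G z) q = dy F q - dy G q := by
  have h : fderiv ℂ (fun z => F z - G z) q = _ :=
    (hF.differentiableAt.hasFDerivAt.sub hG.differentiableAt.hasFDerivAt).fderiv
  rw [dy, h]
  rfl

theorem dx_sub {F G : ℂ × ℂ → ℂ} {q : ℂ × ℂ} (hF : AnalyticAt ℂ F q) (hG : AnalyticAt ℂ G q) :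
    dx (fun z => F z - G z) q = dx F q - dx G q := by
  have h : fderiv ℂ (fun z => F z - G z) q = _ :=
    (hF.differentiableAt.hasFDerivAt.sub hG.differentiableAt.hasFDerivAt).fderiv
  rw [dx, h]
  rfl

theorem dx_const (c : ℂ) (q : ℂ × ℂ) : dx (fun _ => c) q = 0 := by simp [dx]

theorem dy_const (c : ℂ) (q : ℂ × ℂ) : dy (fun _ => c) q = 0 := by simp [dy]

theorem hasFDerivAt_comp_fst {a : ℂ → ℂ} {q : ℂ × ℂ} (ha : AnalyticAt ℂ a q.1) :
    HasFDerivAt (fun z : ℂ × ℂ => a z.1) (deriv a q.1 • ContinuousLinearMap.fst ℂ ℂ ℂ) q :=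
  ha.differentiableAt.hasDerivAt.comp_hasFDerivAt q hasFDerivAt_fst

theorem dx_comp_fst {a : ℂ → ℂ} {q : ℂ × ℂ} (ha : AnalyticAt ℂ a q.1) :
    dx (fun z => a z.1) q = deriv a q.1 := by
  rw [dx, (hasFDerivAt_comp_fst ha).fderiv]
  simp

theorem dy_comp_fst {a : ℂ → ℂ} {q : ℂ × ℂ} (ha : AnalyticAt ℂ a q.1) :
    dy (fun z => a z.1) q = 0 := by
  rw [dy, (hasFDerivAt_comp_fst ha).fderiv]
  simp

/-- Let `G 0 + G 1 + G 2 = 0` be first integrals of the three families `dy = y r_i dx`, with slopes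
`r_i` depending on `x` only. Then the logarithmic derivative `y ∂_y log E_i` of `E_i = y ∂G_i/∂y` is
a constant `Q` that is the same for all `i`, and it is determined by the `r_i` through the stated
equation. -/
theorem exists_const_of_first_integrals {U : Set (ℂ × ℂ)} (hU : IsOpen U) (hUc : IsPreconnected U)
    {G r : Fin 3 → ℂ × ℂ → ℂ} (hG : ∀ i, AnalyticOnNhd ℂ (G i) U)
    (hr : ∀ i, AnalyticOnNhd ℂ (r i) U)
    (hsum : ∀ q ∈ U, G 0 q + G 1 q + G 2 q = 0)
    (hfirst : ∀ i, ∀ q ∈ U, dx (G i) q = -(q.2 * dy (G i) q * r i q))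
    (hy : ∀ q ∈ U, q.2 ≠ 0) (hne : ∀ i, ∀ q ∈ U, dy (G i) q ≠ 0)
    (hdist : ∀ i j, i ≠ j → ∀ q ∈ U, r i q ≠ r j q) (hry : ∀ i, ∀ q ∈ U, dy (r i) q = 0) :
    ∃ Q : ℂ, ∀ q ∈ U,
      (dx (r 0) q - dx (r 2) q) * (r 1 q - r 2 q) - (dx (r 1) q - dx (r 2) q) * (r 0 q - r 2 q) =
        Q * ((r 0 q - r 1 q) * (r 0 q - r 2 q) * (r 1 q - r 2 q)) := by
  rcases U.eq_empty_or_nonempty with rfl | ⟨q₀, hq₀⟩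
  · exact ⟨0, by simp⟩
  have dxc : ∀ {F H : ℂ × ℂ → ℂ}, (∀ q ∈ U, F q = H q) → ∀ q ∈ U, dx F q = dx H q :=
    fun h q hq => dx_congr (eventually_of_mem (hU.mem_nhds hq) h)
  have dyc : ∀ {F H : ℂ × ℂ → ℂ}, (∀ q ∈ U, F q = H q) → ∀ q ∈ U, dy F q = dy H q :=
    fun h q hq => dy_congr (eventually_of_mem (hU.mem_nhds hq) h)
  set E : Fin 3 → ℂ × ℂ → ℂ := fun i q => q.2 * dy (G i) q with hE
  have hEa : ∀ i, AnalyticOnNhd ℂ (E i) U :=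
    fun i q hq => analyticAt_snd.fun_mul (analyticAt_dy (hG i q hq))
  have hE0 : ∀ i, ∀ q ∈ U, E i q ≠ 0 := fun i q hq => mul_ne_zero (hy q hq) (hne i q hq)
  have hfirst' : ∀ i, ∀ q ∈ U, dx (G i) q = (-1) * (E i q * r i q) := by
    intro i q hq
    rw [hfirst i q hq]
    ring
  -- the relation between the `E i`
  have hrel : ∀ q ∈ U, E 0 q * (r 0 q - r 2 q) + E 1 q * (r 1 q - r 2 q) = 0 := by
    intro q hq
    have h1 := dxc hsum q hq
    have h2 := dyc hsum q hq
    rw [dx_const, dx_add ((hG 0 q hq).fun_add (hG 1 q hq)) (hG 2 q hq), dx_add (hG 0 q hq) (hG 1 q hq),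
      hfirst' 0 q hq, hfirst' 1 q hq, hfirst' 2 q hq] at h1
    rw [dy_const, dy_add ((hG 0 q hq).fun_add (hG 1 q hq)) (hG 2 q hq),
      dy_add (hG 0 q hq) (hG 1 q hq)] at h2
    have h3 : E 0 q + E 1 q + E 2 q = 0 := by
      simp only [hE]
      linear_combination q.2 * h2
    linear_combination -h1 - r 2 q * h3
  -- the `x`-derivative of `E i`, from the symmetry of second derivatives
  have hdxE : ∀ i, ∀ q ∈ U, dx (E i) q = -(q.2 * dy (E i) q * r i q) := by
    intro i q hq
    have h1 := dyc (hfirst' i) q hq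
    rw [dy_const_mul _ ((hEa i q hq).fun_mul (hr i q hq)), dy_mul (hEa i q hq) (hr i q hq),
      hry i q hq, ← dx_dy_comm (hG i q hq)] at h1
    have h2 : dx (E i) q = q.2 * dx (dy (G i)) q + dx Prod.snd q * dy (G i) q :=
      dx_mul analyticAt_snd (analyticAt_dy (hG i q hq))
    rw [h2, dx_snd, h1]
    ring
  have hr02 : ∀ i, AnalyticOnNhd ℂ (fun q => r i q - r 2 q) U :=
    fun i q hq => (hr i q hq).fun_sub (hr 2 q hq)
  have hdyrel : ∀ q ∈ U, dy (E 0) q * (r 0 q - r 2 q) + dy (E 1) q * (r 1 q - r 2 q) = 0 := by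
    intro q hq
    have h1 := dyc hrel q hq
    rw [dy_const, dy_add ((hEa 0 q hq).fun_mul (hr02 0 q hq)) ((hEa 1 q hq).fun_mul (hr02 1 q hq)),
      dy_mul (hEa 0 q hq) (hr02 0 q hq), dy_mul (hEa 1 q hq) (hr02 1 q hq),
      dy_sub (hr 0 q hq) (hr 2 q hq), dy_sub (hr 1 q hq) (hr 2 q hq), hry 0 q hq, hry 1 q hq,
      hry 2 q hq] at h1
    linear_combination h1
  have hdxrel : ∀ q ∈ U, E 0 q * (dx (r 0) q - dx (r 2) q) + dx (E 0) q * (r 0 q - r 2 q) +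
      (E 1 q * (dx (r 1) q - dx (r 2) q) + dx (E 1) q * (r 1 q - r 2 q)) = 0 := by
    intro q hq
    have h1 := dxc hrel q hq
    rw [dx_const, dx_add ((hEa 0 q hq).fun_mul (hr02 0 q hq)) ((hEa 1 q hq).fun_mul (hr02 1 q hq)),
      dx_mul (hEa 0 q hq) (hr02 0 q hq), dx_mul (hEa 1 q hq) (hr02 1 q hq),
      dx_sub (hr 0 q hq) (hr 2 q hq), dx_sub (hr 1 q hq) (hr 2 q hq)] at h1
    exact h1
  set Q : ℂ × ℂ → ℂ := fun q => q.2 * dy (E 0) q / E 0 q with hQ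
  have hQa : AnalyticOnNhd ℂ Q U := fun q hq =>
    (analyticAt_snd.fun_mul (analyticAt_dy (hEa 0 q hq))).div (hEa 0 q hq) (hE0 0 q hq)
  have hQE : ∀ q ∈ U, Q q * E 0 q = q.2 * dy (E 0) q := fun q hq =>
    div_mul_cancel₀ _ (hE0 0 q hq)
  have hmain : ∀ q ∈ U,
      Q q * ((r 0 q - r 1 q) * (r 0 q - r 2 q) * (r 1 q - r 2 q)) =
      (dx (r 0) q - dx (r 2) q) * (r 1 q - r 2 q) -
        (dx (r 1) q - dx (r 2) q) * (r 0 q - r 2 q) := by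
    intro q hq
    apply mul_left_cancel₀ (hE0 0 q hq)
    have h1 := hdxrel q hq
    rw [hdxE 0 q hq, hdxE 1 q hq] at h1
    linear_combination (r 0 q - r 1 q) * (r 0 q - r 2 q) * (r 1 q - r 2 q) * hQE q hq -
      (r 1 q - r 2 q) * h1 + (dx (r 1) q - dx (r 2) q) * hrel q hq -
      q.2 * (r 1 q - r 2 q) * r 1 q * hdyrel q hq
  have hdyQ : ∀ q ∈ U, dy Q q = 0 := by
    intro q hq
    have hxr : ∀ i, dy (dx (r i)) q = 0 := by
      intro i
      rw [← dx_dy_comm (hr i q hq), dxc (hry i) q hq, dx_const]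
    have hA : ∀ i j, AnalyticAt ℂ (fun q => r i q - r j q) q :=
      fun i j => (hr i q hq).fun_sub (hr j q hq)
    have hA' : ∀ i j, AnalyticAt ℂ (fun q => dx (r i) q - dx (r j) q) q :=
      fun i j => (analyticAt_dx (hr i q hq)).fun_sub (analyticAt_dx (hr j q hq))
    have hdA : ∀ i j, dy (fun q => r i q - r j q) q = 0 := by
      intro i j
      rw [dy_sub (hr i q hq) (hr j q hq), hry i q hq, hry j q hq, sub_zero]
    have hdA' : ∀ i j, dy (fun q => dx (r i) q - dx (r j) q) q = 0 := by
      intro i j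
      rw [dy_sub (analyticAt_dx (hr i q hq)) (analyticAt_dx (hr j q hq)), hxr, hxr, sub_zero]
    have h1 := dyc hmain q hq
    rw [dy_mul (hQa q hq) (((hA 0 1).fun_mul (hA 0 2)).fun_mul (hA 1 2)),
      dy_mul ((hA 0 1).fun_mul (hA 0 2)) (hA 1 2), dy_mul (hA 0 1) (hA 0 2),
      dy_sub ((hA' 0 2).fun_mul (hA 1 2)) ((hA' 1 2).fun_mul (hA 0 2)), dy_mul (hA' 0 2) (hA 1 2),
      dy_mul (hA' 1 2) (hA 0 2)] at h1
    simp only [hdA, hdA'] at h1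
    have h2 : dy Q q * ((r 0 q - r 1 q) * (r 0 q - r 2 q) * (r 1 q - r 2 q)) = 0 := by
      linear_combination h1
    refine (mul_eq_zero.1 h2).resolve_right (mul_ne_zero (mul_ne_zero ?_ ?_) ?_)
    · exact sub_ne_zero.2 (hdist 0 1 (by decide) q hq)
    · exact sub_ne_zero.2 (hdist 0 2 (by decide) q hq)
    · exact sub_ne_zero.2 (hdist 1 2 (by decide) q hq)
  have hdxQ : ∀ q ∈ U, dx Q q = 0 := by
    intro q hq
    have h1 := dxc hQE q hq
    rw [dx_mul (hQa q hq) (hEa 0 q hq),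
      dx_mul (F := Prod.snd) analyticAt_snd (analyticAt_dy (hEa 0 q hq)), dx_snd,
      dx_dy_comm (hEa 0 q hq)] at h1
    have h2 : ∀ q ∈ U, dx (E 0) q = (-1) * (Q q * E 0 q * r 0 q) := by
      intro q hq
      rw [hdxE 0 q hq, hQE q hq]
      ring
    rw [dyc h2 q hq, dy_const_mul _ (((hQa q hq).fun_mul (hEa 0 q hq)).fun_mul (hr 0 q hq)),
      dy_mul ((hQa q hq).fun_mul (hEa 0 q hq)) (hr 0 q hq), dy_mul (hQa q hq) (hEa 0 q hq),
      hry 0 q hq, hdyQ q hq, h2 q hq] at h1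
    have h3 : E 0 q * dx Q q = 0 := by
      linear_combination h1 + Q q * r 0 q * hQE q hq
    exact (mul_eq_zero.1 h3).resolve_left (hE0 0 q hq)
  refine ⟨Q q₀, fun q hq => ?_⟩
  have hfd : ∀ q ∈ U, fderiv ℂ Q q = 0 := by
    intro q hq
    ext
    · exact hdxQ q hq
    · exact hdyQ q hq
  have : Q q = Q q₀ := hU.is_const_of_fderiv_eq_zero hUc (fun q hq =>
    (hQa q hq).differentiableAt.differentiableWithinAt) hfd hq hq₀
  rw [← this, hmain q hq]

/-- The linear form `b ↦ det2 a b`. -/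
noncomputable def det2Form (a : ℂ × ℂ) : (ℂ × ℂ) →L[ℂ] ℂ :=
  a.1 • ContinuousLinearMap.snd ℂ ℂ ℂ - a.2 • ContinuousLinearMap.fst ℂ ℂ ℂ

theorem det2Form_apply (a b : ℂ × ℂ) : det2Form a b = det2 a b := rfl

theorem eq_zero_of_det2_eq_zero {a b w : ℂ × ℂ} (hab : det2 a b ≠ 0) (ha : det2 a w = 0)
    (hb : det2 b w = 0) : w = 0 := by
  simp only [det2] at *
  ext
  · refine (mul_eq_zero.1 (?_ : (a.1 * b.2 - a.2 * b.1) * w.1 = 0)).resolve_left hab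
    linear_combination b.1 * ha - a.1 * hb
  · refine (mul_eq_zero.1 (?_ : (a.1 * b.2 - a.2 * b.1) * w.2 = 0)).resolve_left hab
    linear_combination b.2 * ha - a.2 * hb

/-- Three distinct roots of a monic cubic determine its coefficients. -/
theorem vieta_cubic {a b c r s t : ℂ} (hr : r ^ 3 + a * r ^ 2 + b * r + c = 0)
    (hs : s ^ 3 + a * s ^ 2 + b * s + c = 0) (ht : t ^ 3 + a * t ^ 2 + b * t + c = 0)
    (hrs : r ≠ s) (hrt : r ≠ t) (hst : s ≠ t) :
    r + s + t = -a ∧ r * s + r * t + s * t = b ∧ r * s * t = -c := by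
  have h1 : r ^ 2 + r * s + s ^ 2 + a * (r + s) + b = 0 := by
    apply mul_left_cancel₀ (sub_ne_zero.2 hrs)
    linear_combination hr - hs
  have h2 : r ^ 2 + r * t + t ^ 2 + a * (r + t) + b = 0 := by
    apply mul_left_cancel₀ (sub_ne_zero.2 hrt)
    linear_combination hr - ht
  have h3 : r + s + t + a = 0 := by
    apply mul_left_cancel₀ (sub_ne_zero.2 hst)
    linear_combination h1 - h2
  have h4 : r * s + r * t + s * t = b := by linear_combination (r + s) * h3 - h1
  refine ⟨by linear_combination h3, h4, ?_⟩
  linear_combination hr - r ^ 2 * h3 + r * h4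

/-- The coefficient of `p` after the substitution that removes the quadratic term of the cubic
`p³ + a p² + b p + c`. -/
noncomputable def depB (a b : ℂ → ℂ) (x : ℂ) : ℂ := b x - a x ^ 2 / 3

/-- The constant coefficient after the substitution that removes the quadratic term of the cubic
`p³ + a p² + b p + c`. -/
noncomputable def depC (a b c : ℂ → ℂ) (x : ℂ) : ℂ := c x - a x * b x / 3 + 2 * a x ^ 3 / 27

theorem analyticAt_depB {a b : ℂ → ℂ} {x : ℂ} (ha : AnalyticAt ℂ a x) (hb : AnalyticAt ℂ b x) :
    AnalyticAt ℂ (depB a b) x := by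
  unfold depB
  fun_prop

theorem analyticAt_depC {a b c : ℂ → ℂ} {x : ℂ} (ha : AnalyticAt ℂ a x) (hb : AnalyticAt ℂ b x)
    (hc : AnalyticAt ℂ c x) : AnalyticAt ℂ (depC a b c) x := by
  unfold depC
  fun_prop

theorem deriv_depB {a b : ℂ → ℂ} {x : ℂ} (ha : AnalyticAt ℂ a x) (hb : AnalyticAt ℂ b x) :
    deriv (depB a b) x = deriv b x - 2 * a x * deriv a x / 3 := by
  have h := hb.differentiableAt.hasDerivAt.sub ((ha.differentiableAt.hasDerivAt.pow 2).div_const 3)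
  have h' : deriv (depB a b) x = _ := h.deriv
  rw [h']
  push_cast
  ring

theorem deriv_depC {a b c : ℂ → ℂ} {x : ℂ} (ha : AnalyticAt ℂ a x) (hb : AnalyticAt ℂ b x)
    (hc : AnalyticAt ℂ c x) : deriv (depC a b c) x =
      deriv c x - (deriv a x * b x + a x * deriv b x) / 3 + 2 * a x ^ 2 * deriv a x / 9 := by
  have h1 := ha.differentiableAt.hasDerivAt
  have h := (hc.differentiableAt.hasDerivAt.sub
    ((h1.mul hb.differentiableAt.hasDerivAt).div_const 3)).add
    (((h1.pow 3).const_mul 2).div_const 27)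
  have h' : deriv (depC a b c) x = _ := h.deriv
  rw [h']
  push_cast
  ring

namespace BinaryCubic

/-- Near a flat point the three coordinates dual to the parallel directions are first integrals of
the three families of solutions, normalized to have sum zero. -/
theorem IsFlatAt.exists_first_integrals {Φ : BinaryCubic} {q₀ : ℂ × ℂ} (h : Φ.IsFlatAt q₀) :
    ∃ G : Fin 3 → ℂ × ℂ → ℂ, (∀ i, AnalyticAt ℂ (G i) q₀) ∧ ∀ᶠ q in 𝓝 q₀,
      G 0 q + G 1 q + G 2 q = 0 ∧
      (∀ v, Φ.eval q v = 0 ↔ ∃ i, fderiv ℂ (G i) q v = 0) ∧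
      ∀ i j, i ≠ j → ∀ v, fderiv ℂ (G i) q v = 0 → fderiv ℂ (G j) q v = 0 → v = 0 := by
  obtain ⟨f, ℓ, hf, hinv, hℓ, hev⟩ := h
  have hopen : ∀ᶠ q' in 𝓝 q₀, (fderiv ℂ f q').IsInvertible := by
    obtain ⟨e, he⟩ := hinv
    filter_upwards [hf.fderiv.continuousAt.eventually (he ▸ ContinuousLinearEquiv.nhds e)]
      with q hq
    exact hq
  set α : Fin 3 → ℂ := ![det2 (ℓ 1) (ℓ 2), det2 (ℓ 2) (ℓ 0), det2 (ℓ 0) (ℓ 1)] with hα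
  have hα0 : ∀ i, α i ≠ 0 := by
    intro i
    fin_cases i
    · exact hℓ 1 2 (by decide)
    · exact hℓ 2 0 (by decide)
    · exact hℓ 0 1 (by decide)
  refine ⟨fun i q => α i * det2Form (ℓ i) (f q), fun i => ?_, ?_⟩
  · exact analyticAt_const.mul (((det2Form (ℓ i)).analyticAt _).comp hf)
  · filter_upwards [hopen, hev, hf.eventually_analyticAt] with q h1 h2 h3
    have hfd : ∀ i v, fderiv ℂ (fun q => α i * det2Form (ℓ i) (f q)) q v =
        α i * det2 (ℓ i) (fderiv ℂ f q v) := by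
      intro i v
      have := ((det2Form (ℓ i)).hasFDerivAt.comp q h3.differentiableAt.hasFDerivAt).const_mul (α i)
      have h' : fderiv ℂ (fun q => α i * det2Form (ℓ i) (f q)) q = _ := this.fderiv
      rw [h']
      simp [det2Form_apply]
    refine ⟨?_, fun v => ?_, fun i j hij v hi hj => ?_⟩
    · simp only [hα, det2Form_apply, det2, Matrix.cons_val]
      ring
    · rw [h2]
      simp only [hfd, mul_eq_zero, hα0, false_or]
    · simp only [hfd, mul_eq_zero, hα0, false_or] at hi hj
      obtain ⟨e, he⟩ := h1
      have := eq_zero_of_det2_eq_zero (hℓ i j hij) hi hj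
      rw [← he] at this
      simpa using this

/-- The local flatness equation: near a flat point the quotient of the Wronskian-type expression
`2 b c' - 3 c b'` by the discriminant of the depressed cubic is constant. -/
theorem IsFlatAt.exists_const {Φ : BinaryCubic} {q₀ : ℂ × ℂ} (h : Φ.IsFlatAt q₀) (hy : q₀.2 ≠ 0)
    {a b c : ℂ → ℂ} (ha : AnalyticAt ℂ a q₀.1) (hb : AnalyticAt ℂ b q₀.1)
    (hc : AnalyticAt ℂ c q₀.1)
    (hform : ∀ᶠ q in 𝓝 q₀, Φ.K₃ q ≠ 0 ∧ Φ.K₂ q = Φ.K₃ q * (q.2 * a q.1) ∧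
      Φ.K₁ q = Φ.K₃ q * (q.2 ^ 2 * b q.1) ∧ Φ.K₀ q = Φ.K₃ q * (q.2 ^ 3 * c q.1)) :
    ∃ κ : ℂ, ∀ᶠ x in 𝓝 q₀.1,
      2 * depB a b x * deriv (depC a b c) x - 3 * depC a b c x * deriv (depB a b) x =
        κ * (4 * depB a b x ^ 3 + 27 * depC a b c x ^ 2) := by
  obtain ⟨G, hG, hev⟩ := h.exists_first_integrals
  have hfst : Tendsto (Prod.fst : ℂ × ℂ → ℂ) (𝓝 q₀) (𝓝 q₀.1) := continuous_fst.continuousAt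
  obtain ⟨ε, hε, hball⟩ := Metric.eventually_nhds_iff_ball.1
    ((hev.and hform).and ((continuous_snd.continuousAt.eventually_ne hy).and
      ((eventually_all.2 fun i => (hG i).eventually_analyticAt).and
        ((hfst.eventually ha.eventually_analyticAt).and
          ((hfst.eventually hb.eventually_analyticAt).and
            (hfst.eventually hc.eventually_analyticAt))))))
  set U := Metric.ball q₀ ε with hUdef
  have hU : IsOpen U := Metric.isOpen_ball
  have hdecomp : ∀ i q (p : ℂ), fderiv ℂ (G i) q (1, p) = dx (G i) q + p * dy (G i) q := by
    intro i q p
    have : ((1 : ℂ), p) = (1, 0) + p • ((0 : ℂ), (1 : ℂ)) := by simp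
    rw [this, map_add, map_smul]
    rfl
  have hne : ∀ i, ∀ q ∈ U, dy (G i) q ≠ 0 := by
    intro i q hq h0
    obtain ⟨⟨⟨-, h1, -⟩, h2, -⟩, -⟩ := hball q hq
    have := (h1 (0, 1)).2 ⟨i, h0⟩
    simp only [eval] at this
    exact h2 (by linear_combination this)
  set r : Fin 3 → ℂ × ℂ → ℂ := fun i q => -(dx (G i) q / (q.2 * dy (G i) q)) with hr
  have hra : ∀ i, AnalyticOnNhd ℂ (r i) U := by
    intro i q hq
    have hGq := (hball q hq).2.2.1 i
    exact ((analyticAt_dx hGq).div (analyticAt_snd.mul (analyticAt_dy hGq))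
      (mul_ne_zero (hball q hq).2.1 (hne i q hq))).neg
  have hfirst : ∀ i, ∀ q ∈ U, dx (G i) q = -(q.2 * dy (G i) q * r i q) := by
    intro i q hq
    have h1 := hne i q hq
    have h2 := (hball q hq).2.1
    simp only [hr]
    field_simp
  have hzero : ∀ i, ∀ q ∈ U, fderiv ℂ (G i) q (1, q.2 * r i q) = 0 := by
    intro i q hq
    rw [hdecomp, hfirst i q hq]
    ring
  have hdist : ∀ i j, i ≠ j → ∀ q ∈ U, r i q ≠ r j q := by
    intro i j hij q hq heq
    have h1 := hzero i q hq
    have h2 := hzero j q hq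
    rw [← heq] at h2
    simpa using (hball q hq).1.1.2.2 i j hij _ h1 h2
  have hroot : ∀ i, ∀ q ∈ U, r i q ^ 3 + a q.1 * r i q ^ 2 + b q.1 * r i q + c q.1 = 0 := by
    intro i q hq
    obtain ⟨⟨⟨-, h1, -⟩, h2, h3, h4, h5⟩, h6, -⟩ := hball q hq
    have := (h1 (1, q.2 * r i q)).2 ⟨i, hzero i q hq⟩
    simp only [eval, h3, h4, h5] at this
    refine (mul_eq_zero.1 (?_ : Φ.K₃ q * q.2 ^ 3 * _ = 0)).resolve_left
      (mul_ne_zero h2 (pow_ne_zero 3 h6))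
    linear_combination this
  have hvieta := fun q hq => vieta_cubic (hroot 0 q hq) (hroot 1 q hq) (hroot 2 q hq)
    (hdist 0 1 (by decide) q hq) (hdist 0 2 (by decide) q hq) (hdist 1 2 (by decide) q hq)
  have hA : ∀ q ∈ U, AnalyticAt ℂ a q.1 := fun q hq => (hball q hq).2.2.2.1
  have hB : ∀ q ∈ U, AnalyticAt ℂ b q.1 := fun q hq => (hball q hq).2.2.2.2.1
  have hC : ∀ q ∈ U, AnalyticAt ℂ c q.1 := fun q hq => (hball q hq).2.2.2.2.2
  have hev1 : ∀ q ∈ U, (fun q => r 0 q + r 1 q + r 2 q) =ᶠ[𝓝 q] fun q => (-1) * a q.1 :=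
    fun q hq => eventually_of_mem (hU.mem_nhds hq) fun z hz =>
      (hvieta z hz).1.trans (neg_one_mul _).symm
  have hev2 : ∀ q ∈ U, (fun q => r 0 q * r 1 q + r 0 q * r 2 q + r 1 q * r 2 q) =ᶠ[𝓝 q]
      fun q => b q.1 :=
    fun q hq => eventually_of_mem (hU.mem_nhds hq) fun z hz => (hvieta z hz).2.1
  have hev3 : ∀ q ∈ U, (fun q => r 0 q * r 1 q * r 2 q) =ᶠ[𝓝 q] fun q => (-1) * c q.1 :=
    fun q hq => eventually_of_mem (hU.mem_nhds hq) fun z hz =>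
      (hvieta z hz).2.2.trans (neg_one_mul _).symm
  -- the slopes do not depend on `y`, since the elementary symmetric functions do not
  have hry : ∀ i, ∀ q ∈ U, dy (r i) q = 0 := by
    intro i q hq
    have R := fun i => hra i q hq
    have hca : AnalyticAt ℂ (fun z : ℂ × ℂ => a z.1) q :=
      AnalyticAt.comp (g := a) (hA q hq) analyticAt_fst
    have hcc : AnalyticAt ℂ (fun z : ℂ × ℂ => c z.1) q :=
      AnalyticAt.comp (g := c) (hC q hq) analyticAt_fst
    have e1 := dy_congr (hev1 q hq)
    have e2 := dy_congr (hev2 q hq)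
    have e3 := dy_congr (hev3 q hq)
    rw [dy_const_mul _ hca, dy_comp_fst (hA q hq), dy_add ((R 0).fun_add (R 1)) (R 2),
      dy_add (R 0) (R 1)] at e1
    rw [dy_comp_fst (hB q hq),
      dy_add (((R 0).fun_mul (R 1)).fun_add ((R 0).fun_mul (R 2))) ((R 1).fun_mul (R 2)),
      dy_add ((R 0).fun_mul (R 1)) ((R 0).fun_mul (R 2)), dy_mul (R 0) (R 1), dy_mul (R 0) (R 2),
      dy_mul (R 1) (R 2)] at e2
    rw [dy_const_mul _ hcc, dy_comp_fst (hC q hq), dy_mul ((R 0).fun_mul (R 1)) (R 2),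
      dy_mul (R 0) (R 1)] at e3
    have d01 := sub_ne_zero.2 (hdist 0 1 (by decide) q hq)
    have d02 := sub_ne_zero.2 (hdist 0 2 (by decide) q hq)
    have d12 := sub_ne_zero.2 (hdist 1 2 (by decide) q hq)
    obtain rfl | rfl | rfl : i = 0 ∨ i = 1 ∨ i = 2 := by fin_cases i <;> simp
    · apply mul_left_cancel₀ (mul_ne_zero d01 d02)
      linear_combination r 0 q ^ 2 * e1 - r 0 q * e2 + e3
    · apply mul_left_cancel₀ (mul_ne_zero d01 d12)
      linear_combination -(r 1 q ^ 2 * e1 - r 1 q * e2 + e3)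
    · apply mul_left_cancel₀ (mul_ne_zero d02 d12)
      linear_combination r 2 q ^ 2 * e1 - r 2 q * e2 + e3
  obtain ⟨Q, hQ⟩ := exists_const_of_first_integrals hU (convex_ball q₀ ε).isPreconnected
    (fun i q hq => (hball q hq).2.2.1 i) hra (fun q hq => (hball q hq).1.1.1) hfirst
    (fun q hq => (hball q hq).2.1) hne hdist hry
  refine ⟨-(Q / 3), ?_⟩
  have hslice : Tendsto (fun x : ℂ => (x, q₀.2)) (𝓝 q₀.1) (𝓝 q₀) :=
    (Continuous.prodMk_left q₀.2).tendsto' _ _ rfl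
  filter_upwards [hslice.eventually (hU.mem_nhds (Metric.mem_ball_self hε))] with x hx
  have R := fun i => hra i _ hx
  have hca : AnalyticAt ℂ (fun z : ℂ × ℂ => a z.1) (x, q₀.2) :=
    AnalyticAt.comp (g := a) (hA _ hx) analyticAt_fst
  have hcc : AnalyticAt ℂ (fun z : ℂ × ℂ => c z.1) (x, q₀.2) :=
    AnalyticAt.comp (g := c) (hC _ hx) analyticAt_fst
  have e1 := dx_congr (hev1 _ hx)
  have e2 := dx_congr (hev2 _ hx)
  have e3 := dx_congr (hev3 _ hx)
  rw [dx_const_mul _ hca, dx_comp_fst (hA _ hx), dx_add ((R 0).fun_add (R 1)) (R 2),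
    dx_add (R 0) (R 1)] at e1
  rw [dx_comp_fst (hB _ hx),
    dx_add (((R 0).fun_mul (R 1)).fun_add ((R 0).fun_mul (R 2))) ((R 1).fun_mul (R 2)),
    dx_add ((R 0).fun_mul (R 1)) ((R 0).fun_mul (R 2)), dx_mul (R 0) (R 1), dx_mul (R 0) (R 2),
    dx_mul (R 1) (R 2)] at e2
  rw [dx_const_mul _ hcc, dx_comp_fst (hC _ hx), dx_mul ((R 0).fun_mul (R 1)) (R 2),
    dx_mul (R 0) (R 1)] at e3
  obtain ⟨v1, v2, v3⟩ := hvieta _ hx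
  have hQx := hQ _ hx
  rw [deriv_depB (hA _ hx) (hB _ hx), deriv_depC (hA _ hx) (hB _ hx) (hC _ hx)]
  simp only [depB, depC]
  simp only at v1 v2 v3 e1 e2 e3
  have ea : a x = -(r 0 (x, q₀.2) + r 1 (x, q₀.2) + r 2 (x, q₀.2)) := by
    rw [v1, neg_neg]
  have ec : c x = -(r 0 (x, q₀.2) * r 1 (x, q₀.2) * r 2 (x, q₀.2)) := by
    rw [v3, neg_neg]
  have ea' : deriv a x = -(dx (r 0) (x, q₀.2) + dx (r 1) (x, q₀.2) + dx (r 2) (x, q₀.2)) := by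
    linear_combination e1
  have ec' : deriv c x = -(r 0 (x, q₀.2) * r 1 (x, q₀.2) * dx (r 2) (x, q₀.2) +
      (r 0 (x, q₀.2) * dx (r 1) (x, q₀.2) + dx (r 0) (x, q₀.2) * r 1 (x, q₀.2)) *
        r 2 (x, q₀.2)) := by
    linear_combination e3
  rw [ea', ← e2, ec', ea, ec, ← v2]
  generalize r 0 (x, q₀.2) = r0 at *
  generalize r 1 (x, q₀.2) = r1 at *
  generalize r 2 (x, q₀.2) = r2 at *
  linear_combination (1 / 3) * (r0 - r1) * (r0 - r2) * (r1 - r2) * hQx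

end BinaryCubic

/-! ### Coordinates on the line adapted to a holomorphic germ -/

/-- A non-vanishing holomorphic germ has a holomorphic logarithm. -/
theorem exists_analytic_log {g : ℂ → ℂ} (hg : AnalyticAt ℂ g 0) (h0 : g 0 ≠ 0) :
    ∃ ℓ : ℂ → ℂ, AnalyticAt ℂ ℓ 0 ∧ ∀ᶠ x in 𝓝 (0 : ℂ), Complex.exp (ℓ x) = g x := by
  refine ⟨fun x => Complex.log (g x / g 0) + Complex.log (g 0), ?_, ?_⟩
  · refine AnalyticAt.add (AnalyticAt.clog (hg.div analyticAt_const h0) ?_) analyticAt_const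
    simp [h0]
  · filter_upwards [hg.continuousAt.eventually_ne h0] with x hx
    rw [Complex.exp_add, Complex.exp_log (div_ne_zero hx h0), Complex.exp_log h0,
      div_mul_cancel₀ _ h0]

/-- The holomorphic solution of the Fuchsian equation `x ψ' + α ψ = α k` with `α > 0`, obtained by
multiplying the Taylor coefficients of `k` by `α / (n + α)`. -/
theorem exists_analytic_fuchsian {k : ℂ → ℂ} (hk : AnalyticAt ℂ k 0) {α : ℝ} (hα : 0 < α) :
    ∃ ψ : ℂ → ℂ, AnalyticAt ℂ ψ 0 ∧ ∀ᶠ x in 𝓝 (0 : ℂ), x * deriv ψ x + α * ψ x = α * k x := by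
  obtain ⟨p, hp⟩ := hk
  obtain ⟨ε, hε, hball⟩ := Metric.eventually_nhds_iff_ball.1 (hasFPowerSeriesAt_iff.1 hp)
  simp only [zero_add, smul_eq_mul] at hball
  set ρ : ℂ := ((ε / 2 : ℝ) : ℂ) with hρ
  have hρn : ‖ρ‖ = ε / 2 := by
    rw [hρ, Complex.norm_real, Real.norm_of_nonneg (by positivity)]
  have hu : Summable fun n => ‖ρ ^ n * p.coeff n‖ := by
    refine (hball ρ ?_).summable.norm
    rw [mem_ball_zero_iff, hρn]
    linarith
  set F : ℕ → ℂ → ℂ := fun n x => (α / (n + α) * p.coeff n) * x ^ n with hF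
  have hpos : ∀ n : ℕ, (0 : ℝ) < n + α := fun n => by positivity
  have hFd : ∀ n, DifferentiableOn ℂ (F n) (Metric.ball 0 (ε / 2)) := fun n => by
    simp only [hF]
    fun_prop
  have hFle : ∀ n x, x ∈ Metric.ball (0 : ℂ) (ε / 2) → ‖F n x‖ ≤ ‖ρ ^ n * p.coeff n‖ := by
    intro n x hx
    rw [mem_ball_zero_iff] at hx
    have h1 : ‖(α : ℂ) / (n + α)‖ ≤ 1 := by
      have : (α : ℂ) / (n + α) = ((α / (n + α) : ℝ) : ℂ) := by push_cast; rfl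
      rw [this, Complex.norm_real, Real.norm_of_nonneg (div_nonneg hα.le (hpos n).le),
        div_le_one (hpos n)]
      linarith [(n.cast_nonneg : (0 : ℝ) ≤ n)]
    rw [norm_mul, norm_mul, norm_mul, norm_pow, norm_pow, hρn, mul_comm]
    have h2 : ‖(α : ℂ) / (n + α)‖ * ‖p.coeff n‖ ≤ ‖p.coeff n‖ :=
      mul_le_of_le_one_left (norm_nonneg _) h1
    gcongr
  have hopen : IsOpen (Metric.ball (0 : ℂ) (ε / 2)) := Metric.isOpen_ball
  have h0 : (0 : ℂ) ∈ Metric.ball (0 : ℂ) (ε / 2) := Metric.mem_ball_self (by positivity)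
  refine ⟨fun x => ∑' n, F n x, (Complex.differentiableOn_tsum_of_summable_norm hu hFd hopen
    hFle).analyticAt (hopen.mem_nhds h0), ?_⟩
  filter_upwards [hopen.mem_nhds h0] with x hx
  have hd := (Complex.hasSum_deriv_of_summable_norm hu hFd hopen hFle hx).mul_left x
  have hs : HasSum (fun n => F n x) (∑' n, F n x) :=
    (Summable.of_norm_bounded hu fun n => hFle n x hx).hasSum
  have hk' := (hball x (Metric.ball_subset_ball (by linarith) hx)).mul_left (α : ℂ)
  refine (hd.add (hs.mul_left (α : ℂ))).unique ?_
  convert hk' using 2 with n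
  have hn : (n : ℂ) + α ≠ 0 := by
    have := (hpos n).ne'
    exact_mod_cast this
  have hder : deriv (F n) x = (α / (n + α) * p.coeff n) * (n * x ^ (n - 1)) := by
    simp [hF]
  rw [hder]
  have hx' : x * (n * x ^ (n - 1)) = n * x ^ n := by
    rcases n with _ | n
    · simp
    · push_cast
      ring
  simp only [hF]
  calc x * (α / (n + α) * p.coeff n * (n * x ^ (n - 1))) + α * (α / (n + α) * p.coeff n * x ^ n)
      = α / (n + α) * p.coeff n * (x * (n * x ^ (n - 1)) + α * x ^ n) := by ring
    _ = α * (x ^ n * p.coeff n) := by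
      rw [hx']
      field_simp

/-- Every germ `f ≠ 0` becomes a monomial in a suitable coordinate `X`, when it transforms as the
coefficient of the differential form `f dx^m`. -/
theorem exists_coordinate {f : ℂ → ℂ} (hf : AnalyticAt ℂ f 0)
    (hf0 : ¬∀ᶠ x in 𝓝 (0 : ℂ), f x = 0) {m : ℕ} (hm : m ≠ 0) :
    ∃ (N : ℕ) (X : ℂ → ℂ), AnalyticAt ℂ X 0 ∧ X 0 = 0 ∧ deriv X 0 ≠ 0 ∧
      ∀ᶠ x in 𝓝 (0 : ℂ), X x ^ N * deriv X x ^ m = f x := by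
  obtain ⟨N, g, hg, hg0, hfg⟩ := hf.exists_eventuallyEq_pow_smul_nonzero_iff.2 hf0
  simp only [sub_zero, smul_eq_mul] at hfg
  -- `k = e^(ℓ/m)` is an `m`-th root of `g`
  obtain ⟨ℓ, hℓ, hℓg⟩ := exists_analytic_log hg hg0
  have hmC : (m : ℂ) ≠ 0 := Nat.cast_ne_zero.2 hm
  have hk : AnalyticAt ℂ (fun x => Complex.exp (ℓ x / m)) 0 := by fun_prop
  have hα : (0 : ℝ) < (N + m) / m := by
    have : (0 : ℝ) < m := Nat.cast_pos.2 (Nat.pos_of_ne_zero hm)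
    positivity
  obtain ⟨ψ, hψ, hode⟩ := exists_analytic_fuchsian hk hα
  have hαC : (((N + m) / m : ℝ) : ℂ) ≠ 0 := by exact_mod_cast hα.ne'
  -- at `x = 0` the equation reads `ψ 0 = k 0`
  have hψ0 : ψ 0 ≠ 0 := by
    have h := hode.self_of_nhds
    rw [zero_mul, zero_add] at h
    rw [mul_left_cancel₀ hαC h]
    exact Complex.exp_ne_zero _
  obtain ⟨ℓ₂, hℓ₂, hℓψ⟩ := exists_analytic_log hψ hψ0
  set α : ℂ := (((N + m) / m : ℝ) : ℂ) with hαdef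
  -- `X = x ψ^(1/α)` solves `X^N X'^m = f`, because `X^α = x^α ψ` has derivative `α x^(α-1) k`
  set X : ℂ → ℂ := fun x => x * Complex.exp (ℓ₂ x / α) with hX
  have hXd : ∀ᶠ x in 𝓝 (0 : ℂ), deriv X x =
      Complex.exp (ℓ₂ x / α) * Complex.exp (ℓ x / m) / ψ x := by
    filter_upwards [hode, hℓψ.eventually_nhds, hℓ₂.eventually_analyticAt,
      hψ.continuousAt.eventually_ne hψ0] with x h1 h2 h3 h4
    have hd2 := h3.differentiableAt.hasDerivAt
    have e1 : HasDerivAt X _ x := (hasDerivAt_id x).mul (hd2.div_const α).cexp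
    have e2 : deriv ψ x = Complex.exp (ℓ₂ x) * deriv ℓ₂ x := by
      rw [← hd2.cexp.deriv]
      exact (EventuallyEq.deriv_eq h2).symm
    rw [e2, h2.self_of_nhds] at h1
    rw [e1.deriv, eq_div_iff h4]
    apply mul_left_cancel₀ hαC
    simp only [id]
    field_simp
    linear_combination h1
  refine ⟨N, X, by fun_prop, by simp [hX], ?_, ?_⟩
  · rw [hXd.self_of_nhds]
    exact div_ne_zero (mul_ne_zero (Complex.exp_ne_zero _) (Complex.exp_ne_zero _)) hψ0
  · filter_upwards [hXd, hfg, hℓg, hℓψ, hψ.continuousAt.eventually_ne hψ0] with x h1 h2 h3 h4 h5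
    have e1 : Complex.exp (ℓ x / m) ^ m = g x := by
      rw [← Complex.exp_nat_mul, mul_div_cancel₀ _ hmC, h3]
    have e2 : Complex.exp (ℓ₂ x / α) ^ (N + m) = ψ x ^ m := by
      rw [← h4, ← Complex.exp_nat_mul, ← Complex.exp_nat_mul, hαdef]
      congr 1
      have : (N : ℂ) + m ≠ 0 := by
        rw [hαdef] at hαC
        push_cast at hαC
        exact (div_ne_zero_iff.1 hαC).1
      push_cast
      field_simp
    rw [h1, h2]
    simp only [hX, mul_pow, div_pow]
    rw [e1]
    field_simp
    rw [← e2]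
    ring

theorem exists_primitive {f : ℂ → ℂ} (hf : AnalyticAt ℂ f 0) :
    ∃ A : ℂ → ℂ, AnalyticAt ℂ A 0 ∧ ∀ᶠ x in 𝓝 (0 : ℂ), deriv A x = f x := by
  obtain ⟨ε, hε, hball⟩ := Metric.eventually_nhds_iff_ball.1 hf.eventually_analyticAt
  have hd : DifferentiableOn ℂ f (Metric.ball 0 ε) := fun x hx =>
    (hball x hx).differentiableAt.differentiableWithinAt
  obtain ⟨A, hA⟩ := hd.isExactOn_ball
  have hopen : IsOpen (Metric.ball (0 : ℂ) ε) := Metric.isOpen_ball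
  have h0 := hopen.mem_nhds (Metric.mem_ball_self (x := (0 : ℂ)) hε)
  refine ⟨A, ?_, ?_⟩
  · exact DifferentiableOn.analyticAt
      (fun x hx => (hA x hx).differentiableAt.differentiableWithinAt) h0
  · filter_upwards [h0] with x hx
    exact (hA x hx).deriv

/-- The inverse `Z` of a coordinate change `X` of the line that fixes the origin. -/
theorem exists_local_inverse {X : ℂ → ℂ} (hX : AnalyticAt ℂ X 0) (hX0 : X 0 = 0)
    (hX' : deriv X 0 ≠ 0) : ∃ Z : ℂ → ℂ, AnalyticAt ℂ Z 0 ∧ Z 0 = 0 ∧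
      (∀ᶠ x in 𝓝 (0 : ℂ), Z (X x) = x) ∧ (∀ᶠ z in 𝓝 (0 : ℂ), X (Z z) = z) ∧
      (∀ᶠ x in 𝓝 (0 : ℂ), deriv Z (X x) * deriv X x = 1) ∧
      ∀ᶠ z in 𝓝 (0 : ℂ), deriv X (Z z) * deriv Z z = 1 := by
  have hstrict := hX.hasStrictDerivAt
  set Z := hstrict.localInverse _ _ _ hX' with hZ
  have hZa : AnalyticAt ℂ Z 0 := by
    have := hX.analyticAt_localInverse hX'
    rwa [hX0] at this
  have hl : ∀ᶠ x in 𝓝 (0 : ℂ), Z (X x) = x := hstrict.eventually_left_inverse hX'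
  have hr : ∀ᶠ z in 𝓝 (0 : ℂ), X (Z z) = z := by
    have := hstrict.eventually_right_inverse hX'
    rwa [hX0] at this
  have hZ0 : Z 0 = 0 := by simpa [hX0] using hl.self_of_nhds
  have hXt : Tendsto X (𝓝 0) (𝓝 0) := by simpa [hX0] using hX.continuousAt.tendsto
  have hZt : Tendsto Z (𝓝 0) (𝓝 0) := by simpa [hZ0] using hZa.continuousAt.tendsto
  have key : ∀ {F H : ℂ → ℂ} {x : ℂ}, AnalyticAt ℂ H x → AnalyticAt ℂ F (H x) →
      (∀ᶠ t in 𝓝 x, F (H t) = t) → deriv F (H x) * deriv H x = 1 := by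
    intro F H x hH hF h
    have h1 : HasDerivAt (fun t => F (H t)) (deriv F (H x) * deriv H x) x :=
      hF.differentiableAt.hasDerivAt.comp x hH.differentiableAt.hasDerivAt
    exact h1.unique ((hasDerivAt_id x).congr_of_eventuallyEq h)
  refine ⟨Z, hZa, hZ0, hl, hr, ?_, ?_⟩
  · filter_upwards [hX.eventually_analyticAt, hXt.eventually hZa.eventually_analyticAt,
      hl.eventually_nhds] with x h1 h2 h3
    exact key h1 h2 h3
  · filter_upwards [hZa.eventually_analyticAt, hZt.eventually hX.eventually_analyticAt,
      hr.eventually_nhds] with x h1 h2 h3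
    exact key h1 h2 h3

/-! ### Integration of the flatness equation -/

theorem sqrt_twentySeven_sq : ((Real.sqrt 27 : ℝ) : ℂ) ^ 2 = 27 := by
  rw [← Complex.ofReal_pow, Real.sq_sqrt (by norm_num)]
  norm_num

theorem sqrt_twentySeven_ne_zero : ((Real.sqrt 27 : ℝ) : ℂ) ≠ 0 := by
  intro h
  have := sqrt_twentySeven_sq
  rw [h] at this
  norm_num at this

theorem eventually_of_eventually_sq {P : ℂ → Prop} (h : ∀ᶠ s in 𝓝 (0 : ℂ), P (s ^ 2)) :
    ∀ᶠ x in 𝓝 (0 : ℂ), P x := by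
  obtain ⟨ε, hε, hball⟩ := Metric.eventually_nhds_iff_ball.1 h
  refine Metric.eventually_nhds_iff_ball.2 ⟨ε ^ 2, by positivity, fun x hx => ?_⟩
  obtain ⟨s, rfl⟩ := IsAlgClosed.exists_pow_nat_eq x (n := 2) (by norm_num)
  refine hball s ?_
  rw [mem_ball_zero_iff] at *
  rw [norm_pow] at hx
  exact lt_of_pow_lt_pow_left₀ 2 hε.le hx

/-- `(2/√27) s^(3N) tan (L₀ s^(N+2) + L₁)` equals `c (s²)`, with denominators cleared, so that
poles of the tangent are allowed. -/
def TanRelation (N : ℕ) (L₀ L₁ : ℂ) (c : ℂ → ℂ) : Prop :=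
  ∀ᶠ s in 𝓝 (0 : ℂ), (Real.sqrt 27 : ℂ) / 2 * c (s ^ 2) * Complex.cos (L₀ * s ^ (N + 2) + L₁) =
    s ^ (3 * N) * Complex.sin (L₀ * s ^ (N + 2) + L₁)

/-- The flatness equation with `b = x^N` is a Riccati equation for `√27 c / (2 x^(3N/2))`. In the
variable `s = √x` put `A = (√27/2) c(s²)`, `B = s^(3N)` and `w = L₀ s^(N+2)`; then
`e^(2iw) (A + iB) / (A - iB)` is constant. -/
theorem exists_tanRelation {N : ℕ} {c : ℂ → ℂ} (hc : AnalyticAt ℂ c 0) {κ : ℂ}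
    (hode : ∀ᶠ x in 𝓝 (0 : ℂ), 2 * x ^ N * deriv c x - 3 * c x * (N * x ^ (N - 1)) =
      κ * (4 * x ^ (3 * N) + 27 * c x ^ 2))
    (hD : ¬∀ᶠ x in 𝓝 (0 : ℂ), 4 * x ^ (3 * N) + 27 * c x ^ 2 = 0) :
    ∃ L₀ L₁ : ℂ, TanRelation N L₀ L₁ c := by
  set t : ℂ := ((Real.sqrt 27 : ℝ) : ℂ) with ht
  have ht2 : t ^ 2 = 27 := sqrt_twentySeven_sq
  have hN2 : (N : ℂ) + 2 ≠ 0 := by exact_mod_cast (by omega : N + 2 ≠ 0)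
  set L₀ : ℂ := 2 * t * κ / (N + 2) with hL₀
  have hsq : Tendsto (fun s : ℂ => s ^ 2) (𝓝 0) (𝓝 0) :=
    (continuous_pow 2).tendsto' _ _ (by simp)
  obtain ⟨ρ, hρ, hball⟩ := Metric.eventually_nhds_iff_ball.1
    ((hsq.eventually hode).and (hsq.eventually hc.eventually_analyticAt))
  set A : ℂ → ℂ := fun s => t / 2 * c (s ^ 2) with hA
  set B : ℂ → ℂ := fun s => s ^ (3 * N) with hB
  set e : ℂ → ℂ := fun s => Complex.exp (2 * Complex.I * (L₀ * s ^ (N + 2))) with he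
  have hAB : ∀ s, 4 * ((A s + Complex.I * B s) * (A s - Complex.I * B s)) =
      4 * (s ^ 2) ^ (3 * N) + 27 * c (s ^ 2) ^ 2 := by
    intro s
    simp only [hA, hB]
    linear_combination c (s ^ 2) ^ 2 * ht2 - 4 * (s ^ (3 * N)) ^ 2 * Complex.I_sq
  obtain ⟨s₁, hs₁, hne⟩ : ∃ s ∈ Metric.ball (0 : ℂ) ρ,
      (A s + Complex.I * B s) * (A s - Complex.I * B s) ≠ 0 := by
    by_contra! hcon
    refine hD (eventually_of_eventually_sq ?_)
    filter_upwards [Metric.ball_mem_nhds _ hρ] with s hs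
    rw [← hAB, hcon s hs, mul_zero]
  have hAa : AnalyticOnNhd ℂ A (Metric.ball 0 ρ) := fun s hs =>
    analyticAt_const.mul (AnalyticAt.comp (g := c) (hball s hs).2 (by fun_prop))
  have hBa : AnalyticOnNhd ℂ B (Metric.ball 0 ρ) := fun s _ => by fun_prop
  have hea : AnalyticOnNhd ℂ e (Metric.ball 0 ρ) := fun s _ => by fun_prop
  have hAd : ∀ s ∈ Metric.ball (0 : ℂ) ρ, HasDerivAt A (t * s * deriv c (s ^ 2)) s := by
    intro s hs
    have h1 : HasDerivAt (fun s => c (s ^ 2)) (deriv c (s ^ 2) * (2 * s)) s := by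
      have := (hball s hs).2.differentiableAt.hasDerivAt.comp s (hasDerivAt_pow 2 s)
      simpa [Function.comp_def] using this
    refine (h1.const_mul (t / 2)).congr_deriv ?_
    ring
  have hBd : ∀ s, HasDerivAt B (3 * N * s ^ (3 * N - 1)) s := by
    intro s
    have := hasDerivAt_pow (3 * N) s
    push_cast at this
    exact this
  have hed : ∀ s, HasDerivAt e (e s * (2 * Complex.I * (2 * t * κ * s ^ (N + 1)))) s := by
    intro s
    have h1 := (((hasDerivAt_pow (N + 2) s).const_mul L₀).const_mul (2 * Complex.I)).cexp
    refine h1.congr_deriv ?_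
    simp only [he, hL₀]
    push_cast
    field_simp
  -- the Riccati equation, as a Wronskian identity
  have hW : ∀ s ∈ Metric.ball (0 : ℂ) ρ,
      (t * s * deriv c (s ^ 2)) * B s - A s * (3 * N * s ^ (3 * N - 1)) =
        2 * t * κ * s ^ (N + 1) * ((A s + Complex.I * B s) * (A s - Complex.I * B s)) := by
    intro s hs
    have h1 := (hball s hs).1
    rw [← hAB] at h1
    have h2 : (N : ℂ) * s ^ (3 * N - 1) = s ^ (N + 1) * (N * (s ^ 2) ^ (N - 1)) := by
      rcases N with _ | n
      · simp
      · have : 3 * (n + 1) - 1 = (n + 1 + 1) + 2 * (n + 1 - 1) := by omega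
        rw [this, pow_add, ← pow_mul]
        ring
    have h3 : s * B s = s ^ (N + 1) * (s ^ 2) ^ N := by
      simp only [hB]
      ring
    simp only [hA] at h1 ⊢
    linear_combination t / 2 * s ^ (N + 1) * h1 + t * deriv c (s ^ 2) * h3 -
      3 * (t / 2 * c (s ^ 2)) * h2
  set V : ℂ → ℂ := fun s => e s * (A s + Complex.I * B s) / (A s - Complex.I * B s) with hV
  have hne' := right_ne_zero_of_mul hne
  have hminus : ContinuousAt (fun s => A s - Complex.I * B s) s₁ :=
    (hAa s₁ hs₁).continuousAt.sub (continuousAt_const.mul (hBa s₁ hs₁).continuousAt)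
  obtain ⟨δ, hδ, hball'⟩ := Metric.eventually_nhds_iff_ball.1
    ((hminus.eventually_ne hne').and (Metric.isOpen_ball.mem_nhds hs₁))
  have hVd : ∀ s ∈ Metric.ball s₁ δ, HasDerivAt V 0 s := by
    intro s hs
    obtain ⟨h1, h2⟩ := hball' s hs
    have hp := (hAd s h2).add ((hBd s).const_mul Complex.I)
    have hm := (hAd s h2).sub ((hBd s).const_mul Complex.I)
    refine (((hed s).mul hp).div hm h1).congr_deriv ?_
    rw [div_eq_zero_iff]
    left
    simp only [Pi.add_apply, Pi.mul_apply, Pi.sub_apply]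
    linear_combination -2 * Complex.I * e s * hW s h2
  have hVc : ∀ s ∈ Metric.ball s₁ δ, V s = V s₁ := fun s hs =>
    Metric.isOpen_ball.is_const_of_deriv_eq_zero (convex_ball s₁ δ).isPreconnected
      (fun s hs => (hVd s hs).differentiableAt.differentiableWithinAt)
      (fun s hs => (hVd s hs).deriv) hs (Metric.mem_ball_self hδ)
  have hk : V s₁ ≠ 0 :=
    div_ne_zero (mul_ne_zero (Complex.exp_ne_zero _) (left_ne_zero_of_mul hne)) hne'
  have hrel : ∀ s ∈ Metric.ball (0 : ℂ) ρ,
      e s * (A s + Complex.I * B s) - V s₁ * (A s - Complex.I * B s) = 0 := by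
    intro s hs
    have han : AnalyticOnNhd ℂ (fun s => e s * (A s + Complex.I * B s) -
        V s₁ * (A s - Complex.I * B s)) (Metric.ball 0 ρ) := fun s hs =>
      ((hea s hs).mul ((hAa s hs).add (analyticAt_const.mul (hBa s hs)))).sub
        (analyticAt_const.mul ((hAa s hs).sub (analyticAt_const.mul (hBa s hs))))
    refine han.eqOn_zero_of_preconnected_of_eventuallyEq_zero
      (convex_ball 0 ρ).isPreconnected hs₁ ?_ hs
    filter_upwards [Metric.ball_mem_nhds s₁ hδ] with s hs
    rw [← hVc s hs]
    have := (hball' s hs).1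
    simp only [hV, Pi.zero_apply]
    field_simp
    simp
  -- `L₁` is chosen such that `e^(-2 i L₁) = -V s₁`
  refine ⟨L₀, Complex.I / 2 * Complex.log (-V s₁), ?_⟩
  set L₁ := Complex.I / 2 * Complex.log (-V s₁) with hL₁
  have hL : Complex.exp (-(2 * Complex.I * L₁)) = -V s₁ := by
    rw [← Complex.exp_log (neg_ne_zero.2 hk), hL₁]
    congr 1
    linear_combination -Complex.log (-V s₁) * Complex.I_sq
  filter_upwards [Metric.ball_mem_nhds _ hρ] with s hs
  have h1 := hrel s hs
  rw [eq_neg_iff_add_eq_zero.2 ((add_comm _ _).trans (by rw [hL, neg_add_cancel]) :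
    V s₁ + Complex.exp (-(2 * Complex.I * L₁)) = 0)] at h1
  set θ := L₀ * s ^ (N + 2) + L₁ with hθ
  have h2 : e s = Complex.exp (θ * Complex.I) * Complex.exp (θ * Complex.I) *
      Complex.exp (-(2 * Complex.I * L₁)) := by
    simp only [he, ← Complex.exp_add]
    congr 1
    rw [hθ]
    ring
  rw [h2] at h1
  have h3 : Complex.exp (θ * Complex.I) * Complex.exp (-θ * Complex.I) = 1 := by
    rw [← Complex.exp_add]
    simp
  change A s * Complex.cos θ = B s * Complex.sin θ
  rw [Complex.cos, Complex.sin]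
  apply mul_left_cancel₀ (Complex.exp_ne_zero (-(2 * Complex.I * L₁)))
  apply mul_left_cancel₀ (Complex.exp_ne_zero (θ * Complex.I))
  linear_combination (1 / 2) * h1 +
    (1 / 2) * Complex.exp (-(2 * Complex.I * L₁)) * (A s - Complex.I * B s) * h3

/-! ### Normalization of the phase -/

theorem TanRelation.isTanCoeff {N : ℕ} {L₀ L₁ : ℂ} {c : ℂ → ℂ} (h : TanRelation N L₀ L₁ c)
    (hc : AnalyticAt ℂ c 0) (hcos : Complex.cos L₁ ≠ 0) : BinaryCubic.IsTanCoeff N L₀ L₁ c := by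
  refine ⟨hc, ?_⟩
  have hcont : ContinuousAt (fun s : ℂ => Complex.cos (L₀ * s ^ (N + 2) + L₁)) 0 := by fun_prop
  have hne := hcont.eventually_ne (y := 0) (by simpa using hcos)
  filter_upwards [(h.and hne).filter_mono nhdsWithin_le_nhds] with s hs
  have ht := sqrt_twentySeven_ne_zero
  rw [Complex.tan_eq_sin_div_cos]
  have h1 := hs.2
  field_simp
  linear_combination 2 * hs.1

/-- If the tangent has a pole at `x = 0`, then the coefficient is a cotangent; the power of `x` in
front is then positive, because the coefficient is holomorphic. -/
theorem TanRelation.isCotCoeff {N : ℕ} {L₀ L₁ : ℂ} {c : ℂ → ℂ} (h : TanRelation N L₀ L₁ c)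
    (hc : AnalyticAt ℂ c 0) (hcos : Complex.cos L₁ = 0) :
    ∃ M : ℕ, N = M + 1 ∧ L₀ ≠ 0 ∧ BinaryCubic.IsCotCoeff M L₀ (fun x => -c x) := by
  have hsin : Complex.sin L₁ ≠ 0 := by
    intro hs
    have := Complex.sin_sq_add_cos_sq L₁
    simp [hs, hcos] at this
  have hrel : ∀ᶠ s in 𝓝 (0 : ℂ), (Real.sqrt 27 : ℂ) / 2 * -c (s ^ 2) *
      Complex.sin (L₀ * s ^ (N + 2)) = s ^ (3 * N) * Complex.cos (L₀ * s ^ (N + 2)) := by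
    filter_upwards [h] with s hs
    rw [Complex.cos_add, Complex.sin_add, hcos] at hs
    apply mul_right_cancel₀ hsin
    linear_combination hs
  have hL₀ : L₀ ≠ 0 := by
    rintro rfl
    obtain ⟨s, hs, hs0⟩ := ((hrel.filter_mono nhdsWithin_le_nhds).and
      (eventually_mem_nhdsWithin (a := (0 : ℂ)) (s := {0}ᶜ))).exists
    simp only [zero_mul, Complex.sin_zero, mul_zero, Complex.cos_zero, mul_one] at hs
    exact pow_ne_zero _ hs0 hs.symm
  obtain ⟨M, rfl⟩ : ∃ M, N = M + 1 := by
    rcases N with _ | M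
    · simpa using hrel.self_of_nhds
    · exact ⟨M, rfl⟩
  refine ⟨M, rfl, hL₀, hc.neg, ?_⟩
  have hw : Tendsto (fun s : ℂ => L₀ * s ^ (M + 3)) (𝓝[≠] 0) (𝓝[≠] 0) := by
    refine tendsto_nhdsWithin_iff.2 ⟨?_, ?_⟩
    · have : Continuous (fun s : ℂ => L₀ * s ^ (M + 3)) := by fun_prop
      exact (this.tendsto' 0 0 (by simp)).mono_left nhdsWithin_le_nhds
    · filter_upwards [self_mem_nhdsWithin] with s hs
      exact mul_ne_zero hL₀ (pow_ne_zero _ hs)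
  have hsin0 : ∀ᶠ w in 𝓝[≠] (0 : ℂ), Complex.sin w ≠ 0 := by
    have hd : HasDerivAt Complex.sin 1 0 := by simpa using Complex.hasDerivAt_sin 0
    simpa using hd.eventually_ne (c := 0) one_ne_zero
  filter_upwards [hrel.filter_mono nhdsWithin_le_nhds, hw.eventually hsin0] with s h1 h2
  have ht := sqrt_twentySeven_ne_zero
  rw [Complex.tan_eq_sin_div_cos]
  have h1' : (Real.sqrt 27 : ℂ) / 2 * -c (s ^ 2) * Complex.sin (L₀ * s ^ (M + 3)) =
    s ^ (3 * (M + 1)) * Complex.cos (L₀ * s ^ (M + 3)) := h1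
  rw [mul_div_assoc', div_div_eq_mul_div, eq_div_iff (mul_ne_zero ht h2)]
  linear_combination 2 * h1'

/-- For odd `N` the two square roots of `x` give opposite phases, so the phase vanishes modulo
`π / 2`. -/
theorem TanRelation.sin_two_mul_eq_zero {N : ℕ} (hN : Odd N) {L₀ L₁ : ℂ} {c : ℂ → ℂ}
    (h : TanRelation N L₀ L₁ c) : Complex.sin (2 * L₁) = 0 := by
  have hneg : Tendsto (fun s : ℂ => -s) (𝓝 0) (𝓝 0) := continuous_neg.tendsto' _ _ neg_zero
  obtain ⟨s, ⟨h1, h2⟩, hs0⟩ := (((h.and (hneg.eventually h)).filter_mono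
    nhdsWithin_le_nhds).and (eventually_mem_nhdsWithin (a := (0 : ℂ)) (s := {0}ᶜ))).exists
  have hN3 : Odd (3 * N) := Odd.mul (by decide) hN
  have hN2 : Odd (N + 2) := hN.add_even (by decide)
  rw [hN3.neg_pow, hN2.neg_pow, neg_sq] at h2
  have hne : s ^ (3 * N) ≠ 0 := pow_ne_zero _ hs0
  have e : 2 * L₁ = (L₀ * s ^ (N + 2) + L₁) + (L₀ * -s ^ (N + 2) + L₁) := by ring
  rw [e, Complex.sin_add]
  apply mul_left_cancel₀ hne
  linear_combination Complex.cos (L₀ * s ^ (N + 2) + L₁) * h2 -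
    Complex.cos (L₀ * -s ^ (N + 2) + L₁) * h1

theorem TanRelation.of_sin_eq_zero {N : ℕ} {L₀ L₁ : ℂ} {c : ℂ → ℂ} (h : TanRelation N L₀ L₁ c)
    (hs : Complex.sin L₁ = 0) : TanRelation N L₀ 0 c := by
  have hcos : Complex.cos L₁ ≠ 0 := by
    intro hc
    have := Complex.sin_sq_add_cos_sq L₁
    simp [hs, hc] at this
  filter_upwards [h] with s h1
  rw [Complex.cos_add, Complex.sin_add, hs] at h1
  rw [add_zero]
  apply mul_right_cancel₀ hcos
  linear_combination h1

theorem TanRelation.add_nat_mul_pi {N : ℕ} {L₀ L₁ : ℂ} {c : ℂ → ℂ} (h : TanRelation N L₀ L₁ c)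
    (n : ℕ) : TanRelation N L₀ (L₁ + n * Real.pi) c := by
  filter_upwards [h] with s h1
  rw [← add_assoc, Complex.cos_antiperiodic.add_nat_mul_eq,
    Complex.sin_antiperiodic.add_nat_mul_eq]
  linear_combination (-1) ^ n * h1

/-- The coordinate change `x ↦ σ² x` with `σ^(N+2) = -1` preserves `x^N dx²` and changes the sign
of the phase. -/
theorem TanRelation.neg_phase {N : ℕ} {L₀ L₁ : ℂ} {c : ℂ → ℂ} (h : TanRelation N L₀ L₁ c)
    {σ : ℂ} (hσ : σ ^ (N + 2) = -1) :
    TanRelation N L₀ (-L₁) (fun x => (σ ^ 6)⁻¹ * c ((σ ^ 2)⁻¹ * x)) := by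
  have hσ0 : σ ≠ 0 := by
    rintro rfl
    rw [zero_pow (by omega)] at hσ
    simp at hσ
  have ht : Tendsto (fun s : ℂ => σ⁻¹ * s) (𝓝 0) (𝓝 0) :=
    (continuous_const_mul σ⁻¹).tendsto' _ _ (mul_zero _)
  filter_upwards [ht.eventually h] with s h1
  have e1 : (σ⁻¹ * s) ^ (N + 2) = -s ^ (N + 2) := by
    rw [mul_pow, inv_pow, hσ, inv_neg, inv_one]
    ring
  have e2 : (σ⁻¹ * s) ^ 2 = (σ ^ 2)⁻¹ * s ^ 2 := by rw [mul_pow, inv_pow]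
  have e3 : (σ ^ 6)⁻¹ * (σ⁻¹ * s) ^ (3 * N) = -s ^ (3 * N) := by
    have : σ ^ 6 * σ ^ (3 * N) = -1 := by
      rw [← pow_add, show 6 + 3 * N = (N + 2) * 3 by ring, pow_mul, hσ]
      ring
    rw [mul_pow, inv_pow, ← mul_assoc, ← mul_inv, this]
    norm_num
  have e4 : L₀ * s ^ (N + 2) + -L₁ = -(L₀ * -s ^ (N + 2) + L₁) := by ring
  rw [e1, e2] at h1
  rw [e4, Complex.cos_neg, Complex.sin_neg]
  linear_combination (σ ^ 6)⁻¹ * h1 + Complex.sin (L₀ * -s ^ (N + 2) + L₁) * e3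

/-- Modulo `π` and up to sign, every phase lies in the upper half-plane `0 ≤ arg < π`. -/
theorem exists_arg_mem (L : ℂ) :
    (∃ n : ℕ, 0 ≤ (L + n * Real.pi).arg ∧ (L + n * Real.pi).arg < Real.pi) ∨
    (0 ≤ (-L).arg ∧ (-L).arg < Real.pi) := by
  rcases lt_trichotomy L.im 0 with h | h | h
  · right
    refine ⟨Complex.arg_nonneg_iff.2 (by simpa using h.le), Complex.arg_lt_pi_iff.2 (Or.inr ?_)⟩
    simpa using h.ne
  · left
    obtain ⟨n, hn⟩ := exists_nat_gt (-L.re / Real.pi)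
    have hre : L + n * Real.pi = ((L.re + n * Real.pi : ℝ) : ℂ) := by
      apply Complex.ext <;> simp [h]
    rw [div_lt_iff₀ Real.pi_pos] at hn
    refine ⟨n, ?_⟩
    rw [hre, Complex.arg_ofReal_of_nonneg (by linarith)]
    exact ⟨le_rfl, Real.pi_pos⟩
  · left
    refine ⟨0, Complex.arg_nonneg_iff.2 (by simpa using h.le), Complex.arg_lt_pi_iff.2 (Or.inr ?_)⟩
    simpa using h.ne'

/-- Normal form of the coefficients `b, c` of a flat equation `p³ + b y² p + c y³ = 0` with
`b ≠ 0`, under changes of the coordinate `x`. -/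
theorem exists_normalForm {b c : ℂ → ℂ} (hb : AnalyticAt ℂ b 0) (hc : AnalyticAt ℂ c 0)
    (hb0 : ¬∀ᶠ x in 𝓝 (0 : ℂ), b x = 0) {κ : ℂ}
    (hode : ∀ᶠ x in 𝓝 (0 : ℂ), 2 * b x * deriv c x - 3 * c x * deriv b x =
      κ * (4 * b x ^ 3 + 27 * c x ^ 2))
    (hD : ¬∀ᶠ x in 𝓝 (0 : ℂ), 4 * b x ^ 3 + 27 * c x ^ 2 = 0) :
    ∃ (N : ℕ) (X C : ℂ → ℂ), AnalyticAt ℂ X 0 ∧ X 0 = 0 ∧ deriv X 0 ≠ 0 ∧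
      (∀ᶠ x in 𝓝 (0 : ℂ), X x ^ N * deriv X x ^ 2 = b x) ∧
      (∀ᶠ x in 𝓝 (0 : ℂ), C (X x) * deriv X x ^ 3 = -c x) ∧
      ((∃ L₀ L₁ : ℂ, Complex.cos L₁ ≠ 0 ∧ (Odd N → L₁ = 0) ∧
        (L₁ ≠ 0 → 0 ≤ L₁.arg ∧ L₁.arg < Real.pi) ∧ BinaryCubic.IsTanCoeff N L₀ L₁ C) ∨
      ∃ (M : ℕ) (L₀ : ℂ), N = M + 1 ∧ L₀ ≠ 0 ∧ BinaryCubic.IsCotCoeff M L₀ (fun x => -C x)) := by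
  obtain ⟨N, X, hX, hX0, hX', hXb⟩ := exists_coordinate hb hb0 two_ne_zero
  obtain ⟨Z, hZ, hZ0, hZX, hXZ, hZX', hXZ'⟩ := exists_local_inverse hX hX0 hX'
  have hXt : Tendsto X (𝓝 0) (𝓝 0) := by simpa [hX0] using hX.continuousAt.tendsto
  have hZt : Tendsto Z (𝓝 0) (𝓝 0) := by simpa [hZ0] using hZ.continuousAt.tendsto
  set C : ℂ → ℂ := fun z => -(c (Z z) * deriv Z z ^ 3) with hCdef
  have hCa : AnalyticAt ℂ C 0 :=
    ((AnalyticAt.comp (g := c) (by rwa [hZ0]) hZ).mul (hZ.deriv.pow 3)).neg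
  have hCX : ∀ᶠ x in 𝓝 (0 : ℂ), C (X x) * deriv X x ^ 3 = -c x := by
    filter_upwards [hZX, hZX'] with x h1 h2
    simp only [hCdef, h1]
    have : (deriv Z (X x) * deriv X x) ^ 3 = 1 := by rw [h2, one_pow]
    linear_combination -c x * this
  have hbZ : ∀ᶠ z in 𝓝 (0 : ℂ), z ^ N = b (Z z) * deriv Z z ^ 2 := by
    filter_upwards [hXZ, hXZ', hZt.eventually hXb] with z h1 h2 h3
    rw [← h3, h1]
    have : (deriv X (Z z) * deriv Z z) ^ 2 = 1 := by rw [h2, one_pow]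
    linear_combination -z ^ N * this
  -- both sides of the equation have weight six under changes of coordinate
  have hdisc : ∀ᶠ z in 𝓝 (0 : ℂ), 4 * z ^ (3 * N) + 27 * C z ^ 2 =
      deriv Z z ^ 6 * (4 * b (Z z) ^ 3 + 27 * c (Z z) ^ 2) := by
    filter_upwards [hbZ] with z h1
    have : z ^ (3 * N) = (z ^ N) ^ 3 := by rw [← pow_mul, mul_comm]
    rw [this, h1]
    simp only [hCdef]
    ring
  have hode' : ∀ᶠ z in 𝓝 (0 : ℂ), 2 * z ^ N * deriv C z - 3 * C z * (N * z ^ (N - 1)) =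
      -κ * (4 * z ^ (3 * N) + 27 * C z ^ 2) := by
    filter_upwards [hdisc, hbZ.eventually_nhds, hZt.eventually hode, hZ.eventually_analyticAt,
      hZt.eventually hb.eventually_analyticAt, hZt.eventually hc.eventually_analyticAt]
      with z h1 h2 h3 h4 h5 h6
    have dZ := h4.differentiableAt.hasDerivAt
    have dZ' := h4.deriv.differentiableAt.hasDerivAt
    have dC : HasDerivAt C _ z :=
      ((h6.differentiableAt.hasDerivAt.comp z dZ).mul (dZ'.pow 3)).neg
    have dB := (h5.differentiableAt.hasDerivAt.comp z dZ).mul (dZ'.pow 2)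
    have e := (hasDerivAt_pow N z).unique (dB.congr_of_eventuallyEq h2)
    rw [e, dC.deriv, h1, h2.self_of_nhds]
    simp only [hCdef, Function.comp_apply, Pi.pow_apply, Nat.cast_ofNat]
    linear_combination -deriv Z z ^ 6 * h3
  have hD' : ¬∀ᶠ z in 𝓝 (0 : ℂ), 4 * z ^ (3 * N) + 27 * C z ^ 2 = 0 := by
    intro hcon
    apply hD
    filter_upwards [hXt.eventually (hcon.and hdisc), hZX, hZX'] with x h1 h2 h3
    rw [h1.2, h2] at h1
    exact (mul_eq_zero.1 h1.1).resolve_left (pow_ne_zero _ (left_ne_zero_of_mul_eq_one h3))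
  obtain ⟨L₀, L₁, hrel⟩ := exists_tanRelation hCa hode' hD'
  by_cases hcos : Complex.cos L₁ = 0
  · obtain ⟨M, hM, hL₀, hcot⟩ := hrel.isCotCoeff hCa hcos
    exact ⟨N, X, C, hX, hX0, hX', hXb, hCX, Or.inr ⟨M, L₀, hM, hL₀, hcot⟩⟩
  by_cases hsin : Complex.sin L₁ = 0
  · refine ⟨N, X, C, hX, hX0, hX', hXb, hCX, Or.inl ⟨L₀, 0, by simp, fun _ => rfl, by simp, ?_⟩⟩
    exact (hrel.of_sin_eq_zero hsin).isTanCoeff hCa (by simp)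
  have hodd : ¬Odd N := by
    intro hN
    have := hrel.sin_two_mul_eq_zero hN
    rw [Complex.sin_two_mul] at this
    simp [hsin, hcos] at this
  rcases exists_arg_mem L₁ with ⟨n, harg⟩ | harg
  · refine ⟨N, X, C, hX, hX0, hX', hXb, hCX, Or.inl ⟨L₀, L₁ + n * Real.pi, ?_,
      fun h => absurd h hodd, fun _ => harg, ?_⟩⟩
    · rw [Complex.cos_antiperiodic.add_nat_mul_eq]
      exact mul_ne_zero (pow_ne_zero _ (by norm_num)) hcos
    · refine (hrel.add_nat_mul_pi n).isTanCoeff hCa ?_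
      rw [Complex.cos_antiperiodic.add_nat_mul_eq]
      exact mul_ne_zero (pow_ne_zero _ (by norm_num)) hcos
  · obtain ⟨σ, hσ⟩ := IsAlgClosed.exists_pow_nat_eq (-1 : ℂ) (n := N + 2) (by omega)
    have hσ0 : σ ≠ 0 := by
      rintro rfl
      rw [zero_pow (by omega)] at hσ
      simp at hσ
    have hdX : ∀ᶠ x in 𝓝 (0 : ℂ), deriv (fun x => σ ^ 2 * X x) x = σ ^ 2 * deriv X x := by
      filter_upwards [hX.eventually_analyticAt] with x h1
      exact (h1.differentiableAt.hasDerivAt.const_mul _).deriv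
    refine ⟨N, fun x => σ ^ 2 * X x, fun x => (σ ^ 6)⁻¹ * C ((σ ^ 2)⁻¹ * x), by fun_prop,
      by simp [hX0], ?_, ?_, ?_, Or.inl ⟨L₀, -L₁, by simpa using hcos, fun h => absurd h hodd,
      fun _ => harg, (hrel.neg_phase hσ).isTanCoeff ?_ (by simpa using hcos)⟩⟩
    · rw [hdX.self_of_nhds]
      exact mul_ne_zero (pow_ne_zero _ hσ0) hX'
    · filter_upwards [hdX, hXb] with x h1 h2
      have : (σ ^ (N + 2)) ^ 2 = 1 := by rw [hσ]; norm_num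
      rw [h1, ← h2]
      linear_combination X x ^ N * deriv X x ^ 2 * this
    · filter_upwards [hdX, hCX] with x h1 h2
      rw [h1, ← h2, inv_mul_cancel_left₀ (pow_ne_zero 2 hσ0)]
      field_simp
    · refine analyticAt_const.mul (AnalyticAt.comp (g := C) (by simpa using hCa) (by fun_prop))

namespace BinaryCubic

/-! ### Fibred changes of coordinates and the classification -/

/-- Equivalences of the form `(x, y) ↦ (X(x), y e^{A(x)})`. -/
theorem equivalent_of_eval {Φ Ψ : BinaryCubic} {X A : ℂ → ℂ} {u : ℂ × ℂ → ℂ}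
    (hX : AnalyticAt ℂ X 0) (hX0 : X 0 = 0) (hX' : deriv X 0 ≠ 0) (hA : AnalyticAt ℂ A 0)
    (hu : AnalyticAt ℂ u 0) (hu0 : u 0 ≠ 0)
    (h : ∀ᶠ q in 𝓝 (0 : ℂ × ℂ), ∀ v : ℂ × ℂ,
      Ψ.eval (X q.1, q.2 * Complex.exp (A q.1)) (deriv X q.1 * v.1,
        Complex.exp (A q.1) * (v.2 + q.2 * deriv A q.1 * v.1)) = u q * Φ.eval q v) :
    Φ.Equivalent Ψ := by
  set f : ℂ × ℂ → ℂ × ℂ := fun q => (X q.1, q.2 * Complex.exp (A q.1)) with hf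
  have hfst : Tendsto (Prod.fst : ℂ × ℂ → ℂ) (𝓝 0) (𝓝 0) := continuous_fst.tendsto' _ _ rfl
  have hfa : AnalyticAt ℂ f 0 :=
    (AnalyticAt.comp (g := X) (x := (0 : ℂ × ℂ)) hX analyticAt_fst).prod
      (analyticAt_snd.mul (AnalyticAt.comp (g := A) (x := (0 : ℂ × ℂ)) hA analyticAt_fst).cexp)
  have hfd : ∀ q : ℂ × ℂ, AnalyticAt ℂ X q.1 → AnalyticAt ℂ A q.1 → ∀ v, fderiv ℂ f q v =
      (deriv X q.1 * v.1, Complex.exp (A q.1) * (v.2 + q.2 * deriv A q.1 * v.1)) := by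
    intro q h1 h2 v
    have d : HasFDerivAt f _ q :=
      (hasFDerivAt_comp_fst h1).prodMk (hasFDerivAt_snd.mul (hasFDerivAt_comp_fst h2).cexp)
    rw [d.fderiv]
    ext
    · simp
    · simp
      ring
  refine ⟨f, u, hfa, by simp [hf, hX0], ?_, hu, hu0, ?_⟩
  · refine ⟨(ContinuousLinearEquiv.unitsEquivAut ℂ (Units.mk0 _ hX')).prodCongr
      (ContinuousLinearEquiv.unitsEquivAut ℂ (Units.mk0 _ (Complex.exp_ne_zero (A 0)))), ?_⟩
    refine ContinuousLinearMap.ext fun v => ?_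
    rw [hfd 0 hX hA]
    ext
    · simp [mul_comm]
    · simp [mul_comm]
  · filter_upwards [h, hfst.eventually hX.eventually_analyticAt,
      hfst.eventually hA.eventually_analyticAt] with q h1 h2 h3 v
    rw [hfd q h2 h3, ← h1 v]

/-- Near the origin `Φ = K₃ (dy³ + a y dy² dx + b y² dy dx² + c y³ dx³)` with `K₃ ≠ 0` and
coefficients `a, b, c` that depend on `x` alone. -/
def HasCubicCoeffs (Φ : BinaryCubic) (a b c : ℂ → ℂ) : Prop :=
  ∀ᶠ q in 𝓝 (0 : ℂ × ℂ), Φ.K₃ q ≠ 0 ∧ Φ.K₂ q = Φ.K₃ q * (q.2 * a q.1) ∧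
    Φ.K₁ q = Φ.K₃ q * (q.2 ^ 2 * b q.1) ∧ Φ.K₀ q = Φ.K₃ q * (q.2 ^ 3 * c q.1)

/-- Removing the quadratic term by `y ↦ y e^{A(x)}` with `A' = a / 3` and changing `x` to `X(x)`. -/
theorem HasCubicCoeffs.equivalent {Φ Ψ : BinaryCubic} {a b c : ℂ → ℂ}
    (h : Φ.HasCubicCoeffs a b c) (hK₃ : AnalyticAt ℂ Φ.K₃ 0) (ha : AnalyticAt ℂ a 0)
    {B C X : ℂ → ℂ} (hX : AnalyticAt ℂ X 0) (hX0 : X 0 = 0) (hX' : deriv X 0 ≠ 0)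
    (hB : ∀ᶠ x in 𝓝 (0 : ℂ), B (X x) * deriv X x ^ 2 = depB a b x)
    (hC : ∀ᶠ x in 𝓝 (0 : ℂ), C (X x) * deriv X x ^ 3 = depC a b c x)
    (h3 : ∀ q, Ψ.K₃ q = 1) (h2 : ∀ q, Ψ.K₂ q = 0) (h1 : ∀ q, Ψ.K₁ q = B q.1 * q.2 ^ 2)
    (h0 : ∀ q, Ψ.K₀ q = C q.1 * q.2 ^ 3) : Φ.Equivalent Ψ := by
  obtain ⟨A, hA, hA'⟩ := exists_primitive (f := fun x => a x / 3) (by fun_prop)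
  have hK₃0 : Φ.K₃ 0 ≠ 0 := h.self_of_nhds.1
  have hfst : Tendsto (Prod.fst : ℂ × ℂ → ℂ) (𝓝 0) (𝓝 0) := continuous_fst.tendsto' _ _ rfl
  refine equivalent_of_eval (u := fun q => Complex.exp (A q.1) ^ 3 / Φ.K₃ q) hX hX0 hX' hA ?_
    (div_ne_zero (pow_ne_zero _ (Complex.exp_ne_zero _)) hK₃0) ?_
  · exact (((AnalyticAt.comp (g := A) (x := (0 : ℂ × ℂ)) hA analyticAt_fst).cexp.pow 3).div
      hK₃ hK₃0)
  · filter_upwards [h, hfst.eventually hA', hfst.eventually hB, hfst.eventually hC]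
      with q ⟨hk, e2, e1, e0⟩ eA eB eC v
    simp only [eval, h3, h2, h1, h0, e2, e1, e0, eA]
    simp only [depB, depC] at eB eC
    have e : Complex.exp (A q.1) ^ 3 / Φ.K₃ q * (Φ.K₃ q * v.2 ^ 3 +
        Φ.K₃ q * (q.2 * a q.1) * v.2 ^ 2 * v.1 + Φ.K₃ q * (q.2 ^ 2 * b q.1) * v.2 * v.1 ^ 2 +
        Φ.K₃ q * (q.2 ^ 3 * c q.1) * v.1 ^ 3) =
        Complex.exp (A q.1) ^ 3 * (v.2 ^ 3 + q.2 * a q.1 * v.2 ^ 2 * v.1 +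
          q.2 ^ 2 * b q.1 * v.2 * v.1 ^ 2 + q.2 ^ 3 * c q.1 * v.1 ^ 3) := by
      field_simp
    rw [e]
    linear_combination Complex.exp (A q.1) ^ 3 * (q.2 ^ 2 * (v.2 + q.2 * (a q.1 / 3) * v.1) *
      v.1 ^ 2 * eB + q.2 ^ 3 * v.1 ^ 3 * eC)

theorem IsFlat.not_eventually_disc_eq_zero {Φ : BinaryCubic} (h : Φ.IsFlat) :
    ¬∀ᶠ q in 𝓝 (0 : ℂ × ℂ), Φ.disc q = 0 := by
  intro hcon
  obtain ⟨q, h1, h2⟩ := (h.1.and_eventually hcon).exists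
  exact h1.disc_ne_zero h2

theorem HasCubicCoeffs.eventually_disc {Φ : BinaryCubic} {a b c : ℂ → ℂ}
    (h : Φ.HasCubicCoeffs a b c) : ∀ᶠ q in 𝓝 (0 : ℂ × ℂ), Φ.disc q =
      -(Φ.K₃ q ^ 4 * q.2 ^ 6) * (4 * depB a b q.1 ^ 3 + 27 * depC a b c q.1 ^ 2) := by
  filter_upwards [h] with q ⟨_, e2, e1, e0⟩
  simp only [disc, e2, e1, e0, depB, depC]
  ring

/-- The flatness equation at a single regular point propagates to the origin by analytic
continuation. -/
theorem HasCubicCoeffs.exists_flatness_const {Φ : BinaryCubic} {a b c : ℂ → ℂ}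
    (h : Φ.HasCubicCoeffs a b c) (hflat : Φ.IsFlat) (ha : AnalyticAt ℂ a 0)
    (hb : AnalyticAt ℂ b 0) (hc : AnalyticAt ℂ c 0) :
    ∃ κ : ℂ, ∀ᶠ x in 𝓝 (0 : ℂ),
      2 * depB a b x * deriv (depC a b c) x - 3 * depC a b c x * deriv (depB a b) x =
        κ * (4 * depB a b x ^ 3 + 27 * depC a b c x ^ 2) := by
  obtain ⟨ρ, hρ, hball⟩ := Metric.eventually_nhds_iff_ball.1 (ha.eventually_analyticAt.and
    (hb.eventually_analyticAt.and hc.eventually_analyticAt))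
  have hfst : Tendsto (Prod.fst : ℂ × ℂ → ℂ) (𝓝 0) (𝓝 0) := continuous_fst.tendsto' _ _ rfl
  obtain ⟨q₀, ⟨hreg, hflat₀⟩, h1, h2, h3⟩ := ((hflat.1.and_eventually hflat.2).and_eventually
    ((eventually_eventually_nhds.2 h).and (h.eventually_disc.and
      (hfst.eventually (Metric.ball_mem_nhds 0 hρ))))).exists
  have hy : q₀.2 ≠ 0 := by
    intro hy
    apply hreg.disc_ne_zero
    rw [h2, hy]
    ring
  obtain ⟨ha', hb', hc'⟩ := hball _ h3
  obtain ⟨κ, hκ⟩ := (hflat₀ hreg).exists_const hy ha' hb' hc' h1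
  refine ⟨κ, ?_⟩
  have han : AnalyticOnNhd ℂ (fun x => 2 * depB a b x * deriv (depC a b c) x -
      3 * depC a b c x * deriv (depB a b) x -
        κ * (4 * depB a b x ^ 3 + 27 * depC a b c x ^ 2)) (Metric.ball 0 ρ) := by
    intro x hx
    obtain ⟨h1, h2, h3⟩ := hball x hx
    have hB := analyticAt_depB h1 h2
    have hC := analyticAt_depC h1 h2 h3
    exact (((analyticAt_const.mul hB).mul hC.deriv).sub
      ((analyticAt_const.mul hC).mul hB.deriv)).sub (analyticAt_const.mul
        ((analyticAt_const.mul (hB.pow 3)).add (analyticAt_const.mul (hC.pow 2))))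
  have h0 := han.eqOn_zero_of_preconnected_of_eventuallyEq_zero
    (convex_ball 0 ρ).isPreconnected h3 (hκ.mono fun x hx => sub_eq_zero.2 hx)
  filter_upwards [Metric.ball_mem_nhds 0 hρ] with x hx
  exact sub_eq_zero.1 (h0 hx)

/-- The classification when the coefficient of `dy³` does not vanish at the origin, so that `dx = 0`
is not a direction of the web there. -/
theorem HasCubicCoeffs.classification {Φ : BinaryCubic} {a b c : ℂ → ℂ}
    (h : Φ.HasCubicCoeffs a b c) (hK₃ : AnalyticAt ℂ Φ.K₃ 0) (hflat : Φ.IsFlat)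
    (ha : AnalyticAt ℂ a 0) (hb : AnalyticAt ℂ b 0) (hc : AnalyticAt ℂ c 0) :
    (∃ N : ℕ, Φ.Equivalent (form1 N)) ∨
    (∃ (N : ℕ) (L₀ L₁ : ℂ) (C : ℂ → ℂ),
      Complex.cos L₁ ≠ 0 ∧ (Odd N → L₁ = 0) ∧
      (L₁ ≠ 0 → 0 ≤ Complex.arg L₁ ∧ Complex.arg L₁ < Real.pi) ∧
      IsTanCoeff N L₀ L₁ C ∧ Φ.Equivalent (form2 N C)) ∨
    (∃ (N : ℕ) (L₀ : ℂ) (C : ℂ → ℂ),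
      L₀ ≠ 0 ∧ IsCotCoeff N L₀ C ∧ Φ.Equivalent (form3 N C)) := by
  have hB := analyticAt_depB ha hb
  have hC := analyticAt_depC ha hb hc
  have hfst : Tendsto (Prod.fst : ℂ × ℂ → ℂ) (𝓝 0) (𝓝 0) := continuous_fst.tendsto' _ _ rfl
  have hD : ¬∀ᶠ x in 𝓝 (0 : ℂ), 4 * depB a b x ^ 3 + 27 * depC a b c x ^ 2 = 0 := by
    intro hcon
    apply hflat.not_eventually_disc_eq_zero
    filter_upwards [h.eventually_disc, hfst.eventually hcon] with q h1 h2
    rw [h1, h2, mul_zero]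
  by_cases hB0 : ∀ᶠ x in 𝓝 (0 : ℂ), depB a b x = 0
  · left
    have hC0 : ¬∀ᶠ x in 𝓝 (0 : ℂ), -depC a b c x = 0 := by
      intro hcon
      apply hD
      filter_upwards [hB0, hcon] with x h1 h2
      rw [h1, neg_eq_zero.1 h2]
      norm_num
    obtain ⟨N, X, hX, hX0, hX', hXC⟩ := exists_coordinate hC.neg hC0 three_ne_zero
    refine ⟨N, h.equivalent hK₃ ha (B := fun _ => 0) (C := fun x => -x ^ N) hX hX0 hX' ?_ ?_
      (fun _ => rfl) (fun _ => rfl) (fun _ => (zero_mul _).symm) (fun _ => (neg_mul _ _).symm)⟩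
    · filter_upwards [hB0] with x hx
      rw [hx, zero_mul]
    · filter_upwards [hXC] with x hx
      rw [Pi.neg_apply] at hx
      linear_combination -hx
  · right
    obtain ⟨κ, hκ⟩ := h.exists_flatness_const hflat ha hb hc
    obtain ⟨N, X, C, hX, hX0, hX', hXB, hXC, hcase⟩ := exists_normalForm hB hC hB0 hκ hD
    have hXC' : ∀ᶠ x in 𝓝 (0 : ℂ), -C (X x) * deriv X x ^ 3 = depC a b c x := by
      filter_upwards [hXC] with x hx
      rw [neg_mul, hx, neg_neg]
    rcases hcase with ⟨L₀, L₁, h1, h2, h3, h4⟩ | ⟨M, L₀, rfl, h1, h2⟩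
    · exact Or.inl ⟨N, L₀, L₁, C, h1, h2, h3, h4, h.equivalent hK₃ ha (B := fun x => x ^ N)
        (C := fun x => -C x) hX hX0 hX' hXB hXC' (fun _ => rfl) (fun _ => rfl) (fun _ => rfl)
        (fun _ => (neg_mul _ _).symm)⟩
    · exact Or.inr ⟨M, L₀, fun x => -C x, h1, h2, h.equivalent hK₃ ha
        (B := fun x => x ^ (M + 1)) (C := fun x => -C x) hX hX0 hX' hXB hXC' (fun _ => rfl)
        (fun _ => rfl) (fun _ => rfl) (fun _ => rfl)⟩

/-- If `dx = 0` is one of the three families, the form is `K₂ dx (dy² + a y dy dx + b y² dx²)`, and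
it reduces to the fourth normal form. Such a web is always flat. -/
theorem equivalent_form4 {Φ : BinaryCubic} (hflat : Φ.IsFlat) {a b : ℂ → ℂ}
    (hK₂ : AnalyticAt ℂ Φ.K₂ 0) (hK₂0 : Φ.K₂ 0 ≠ 0)
    (ha : AnalyticAt ℂ a 0) (hb : AnalyticAt ℂ b 0)
    (h : ∀ᶠ q in 𝓝 (0 : ℂ × ℂ), Φ.K₃ q = 0 ∧ Φ.K₁ q = Φ.K₂ q * (q.2 * a q.1) ∧
      Φ.K₀ q = Φ.K₂ q * (q.2 ^ 2 * b q.1)) : ∃ N : ℕ, Φ.Equivalent (form4 N) := by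
  have hfst : Tendsto (Prod.fst : ℂ × ℂ → ℂ) (𝓝 0) (𝓝 0) := continuous_fst.tendsto' _ _ rfl
  have hβ : AnalyticAt ℂ (fun x => b x - a x ^ 2 / 4) 0 := by fun_prop
  have hβ0 : ¬∀ᶠ x in 𝓝 (0 : ℂ), b x - a x ^ 2 / 4 = 0 := by
    intro hcon
    apply hflat.not_eventually_disc_eq_zero
    filter_upwards [h, hfst.eventually hcon] with q ⟨e3, e1, e0⟩ h2
    simp only [disc, e3, e1, e0]
    linear_combination -4 * Φ.K₂ q ^ 4 * q.2 ^ 2 * h2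
  -- `form4` has the coordinates exchanged: there the third family is `dy = 0`
  obtain ⟨N, X, hX, hX0, hX', hXβ⟩ := exists_coordinate hβ hβ0 two_ne_zero
  obtain ⟨A, hA, hA'⟩ := exists_primitive (f := fun x => a x / 2) (by fun_prop)
  refine ⟨N, Equivalent.swap_right (Ψ := (form4 N).swap) ?_⟩
  refine equivalent_of_eval (u := fun q => deriv X q.1 * Complex.exp (A q.1) ^ 2 / Φ.K₂ q)
    hX hX0 hX' hA ?_
    (div_ne_zero (mul_ne_zero hX' (pow_ne_zero _ (Complex.exp_ne_zero _))) hK₂0) ?_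
  · exact ((AnalyticAt.comp (g := deriv X) (x := (0 : ℂ × ℂ)) hX.deriv analyticAt_fst).mul
      ((AnalyticAt.comp (g := A) (x := (0 : ℂ × ℂ)) hA analyticAt_fst).cexp.pow 2)).div hK₂ hK₂0
  · filter_upwards [h, hfst.eventually hA', hfst.eventually hXβ,
      hK₂.continuousAt.eventually_ne hK₂0] with q ⟨e3, e1, e0⟩ eA eX hk v
    simp only [eval, swap, form4, e3, e1, e0, eA, Prod.fst_swap, Prod.snd_swap]
    have e : deriv X q.1 * Complex.exp (A q.1) ^ 2 / Φ.K₂ q * (0 * v.2 ^ 3 +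
        Φ.K₂ q * v.2 ^ 2 * v.1 + Φ.K₂ q * (q.2 * a q.1) * v.2 * v.1 ^ 2 +
        Φ.K₂ q * (q.2 ^ 2 * b q.1) * v.1 ^ 3) = deriv X q.1 * Complex.exp (A q.1) ^ 2 *
        (v.2 ^ 2 * v.1 + q.2 * a q.1 * v.2 * v.1 ^ 2 + q.2 ^ 2 * b q.1 * v.1 ^ 3) := by
      field_simp
      ring
    rw [e]
    linear_combination deriv X q.1 * Complex.exp (A q.1) ^ 2 * q.2 ^ 2 * v.1 ^ 3 * eX

/-- The classification for webs invariant under scaling of `y`. -/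
theorem classification_of_scaling {Φ : BinaryCubic} (hΦ : Φ.IsHolomorphicGerm) (hflat : Φ.IsFlat)
    {w : ℂ} (hhom : Φ.IsWeightedHomogeneous 0 w) :
    (∃ N : ℕ, Φ.Equivalent (form1 N)) ∨
    (∃ (N : ℕ) (L₀ L₁ : ℂ) (c : ℂ → ℂ),
      Complex.cos L₁ ≠ 0 ∧ (Odd N → L₁ = 0) ∧
      (L₁ ≠ 0 → 0 ≤ Complex.arg L₁ ∧ Complex.arg L₁ < Real.pi) ∧
      IsTanCoeff N L₀ L₁ c ∧ Φ.Equivalent (form2 N c)) ∨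
    (∃ (N : ℕ) (L₀ : ℂ) (c : ℂ → ℂ),
      L₀ ≠ 0 ∧ IsCotCoeff N L₀ c ∧ Φ.Equivalent (form3 N c)) ∨
    (∃ N : ℕ, Φ.Equivalent (form4 N)) := by
  have hw : w ≠ 0 := by simpa using hhom.1
  have hK₃ : AnalyticAt ℂ Φ.K₃ 0 := hΦ.analyticAt_coeff 3
  have hK₂ : AnalyticAt ℂ Φ.K₂ 0 := hΦ.analyticAt_coeff 2
  by_cases h3 : Φ.K₃ 0 = 0
  swap
  · obtain ⟨a, ha, ha'⟩ := exists_coeff_eq hΦ hflat hw hhom (i := 2) (j := 3) h3 1 rfl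
    obtain ⟨b, hb, hb'⟩ := exists_coeff_eq hΦ hflat hw hhom (i := 1) (j := 3) h3 2 rfl
    obtain ⟨c, hc, hc'⟩ := exists_coeff_eq hΦ hflat hw hhom (i := 0) (j := 3) h3 3 rfl
    have h : Φ.HasCubicCoeffs a b c := by
      filter_upwards [hK₃.continuousAt.eventually_ne h3, ha', hb', hc'] with q h1 h2 h3 h4
      rw [pow_one] at h2
      exact ⟨h1, h2, h3, h4⟩
    rcases h.classification hK₃ hflat ha hb hc with h | h | h
    · exact Or.inl h
    · exact Or.inr (Or.inl h)
    · exact Or.inr (Or.inr (Or.inl h))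
  by_cases h2 : Φ.K₂ 0 = 0
  swap
  · obtain ⟨a, ha, ha'⟩ := exists_coeff_eq hΦ hflat hw hhom (i := 1) (j := 2) h2 1 rfl
    obtain ⟨b, hb, hb'⟩ := exists_coeff_eq hΦ hflat hw hhom (i := 0) (j := 2) h2 2 rfl
    have hz := coeff_eventually_eq_zero hΦ hflat hw hhom (i := 3) (j := 2) h2 (by decide)
    refine Or.inr (Or.inr (Or.inr (equivalent_form4 hflat hK₂ h2 ha hb ?_)))
    filter_upwards [hz, ha', hb'] with q h1 h2 h3
    rw [pow_one] at h2
    exact ⟨h1, h2, h3⟩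
  -- if only `K₀` or `K₁` is non-zero at the origin, then `dx = 0` is a double direction
  exfalso
  obtain ⟨j, hj, hj0⟩ : ∃ j : Fin 4, j < 2 ∧ Φ.coeff j 0 ≠ 0 := by
    rcases hΦ.2.2.2.2 with h | h | h | h
    · exact ⟨0, by decide, h⟩
    · exact ⟨1, by decide, h⟩
    · exact absurd h2 h
    · exact absurd h3 h
  apply hflat.not_eventually_disc_eq_zero
  filter_upwards [coeff_eventually_eq_zero hΦ hflat hw hhom (i := 2) hj0 hj,
    coeff_eventually_eq_zero hΦ hflat hw hhom (i := 3) hj0 (hj.trans (by decide))] with q e2 e3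
  have e2' : Φ.K₂ q = 0 := e2
  have e3' : Φ.K₃ q = 0 := e3
  rw [disc, e2', e3']
  ring

end BinaryCubic

theorem theorem5 (Φ : BinaryCubic) (hΦ : Φ.IsHolomorphicGerm) (hflat : Φ.IsFlat)
    (wx wy : ℂ) (hhom : Φ.IsWeightedHomogeneous wx wy) (hw : wx = 0 ∨ wy = 0) :
    (∃ N : ℕ, Φ.Equivalent (BinaryCubic.form1 N)) ∨
    (∃ (N : ℕ) (L₀ L₁ : ℂ) (c : ℂ → ℂ),
      Complex.cos L₁ ≠ 0 ∧ (Odd N → L₁ = 0) ∧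
      (L₁ ≠ 0 → 0 ≤ Complex.arg L₁ ∧ Complex.arg L₁ < Real.pi) ∧
      BinaryCubic.IsTanCoeff N L₀ L₁ c ∧ Φ.Equivalent (BinaryCubic.form2 N c)) ∨
    (∃ (N : ℕ) (L₀ : ℂ) (c : ℂ → ℂ),
      L₀ ≠ 0 ∧ BinaryCubic.IsCotCoeff N L₀ c ∧ Φ.Equivalent (BinaryCubic.form3 N c)) ∨
    (∃ N : ℕ, Φ.Equivalent (BinaryCubic.form4 N)) := by
  rcases hw with rfl | rfl
  · exact BinaryCubic.classification_of_scaling hΦ hflat hhom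
  · rcases BinaryCubic.classification_of_scaling (BinaryCubic.isHolomorphicGerm_swap hΦ)
      (BinaryCubic.isFlat_swap hflat) (BinaryCubic.isWeightedHomogeneous_swap hhom) with
      ⟨N, h⟩ | ⟨N, L₀, L₁, c, h1, h2, h3, h4, h⟩ | ⟨N, L₀, c, h1, h2, h⟩ | ⟨N, h⟩
    · exact Or.inl ⟨N, h.swap_left⟩
    · exact Or.inr (Or.inl ⟨N, L₀, L₁, c, h1, h2, h3, h4, h.swap_left⟩)
    · exact Or.inr (Or.inr (Or.inl ⟨N, L₀, c, h1, h2, h.swap_left⟩))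
    · exact Or.inr (Or.inr (Or.inr ⟨N, h.swap_left⟩))
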